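/- Let $F$ be a distribution function on $\mathbb R$, let $(X_i)_{i\in\mathbb Z}$ be independent random variables with distribution $F$, and let $(c_i)_{i\in\mathbb Z}$ be real numbers. For a distribution function $K$ write $\overline K=1-K$; let $M_cF$ be the distribution of $cX_0$, let $G$ be the distribution of $\sum_{i\in\mathbb Z}c_iX_i$, and let $G\natural M_{c_i}F$ be the distribution of $\sum_{j\neq i}c_jX_j$. Let $h=F'/\overline F$ be the hazard rate of $F$ and $h_-$ the hazard rate of $M_{-1}F$. A function is smoothly varying of index $\alpha$ and order $m$ if it is ultimately $m$ times continuously differentiable and its $m$-th derivative is regularly varying of index $\alpha-m$ at infinity (a regularly varying function may be ultimately negative here). For real $a,b$ write $a\prec b$ if $\overline{M_aF}=o(\overline{M_bF})$ at infinity, $a\equiv b$ if there is $\epsilon>0$ with $\epsilon\overline{M_aF}\le\overline{M_bF}\le\epsilon^{-1}\overline{M_aF}$ ultimately, and $a\preceq b$ (equivalently $b\succeq a$) if $a\prec b$ or $a\equiv b$. For a distribution function $K$ with moments $\mu_{K,j}=\int x^j\,dK(x)$, its Laplace character of order $p$ is the differential operator $L_{K,p}=\sum_{0\le j\le p}\frac{(-1)^j}{j!}\mu_{K,j}D^j$,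 where $D$ is differentiation (an empty sum, if $p<0$, is $0$). Let $\lambda>0$ and let $m$ be a nonnegative integer. Assume that (i) $h(t)\sim\lambda t^{-1}\log t$ as $t\to\infty$; (ii) $h$ is smoothly varying of index $-1$ and order $m$; (iii) $\sum_{i\in\mathbb Z}|c_i|^\delta<\infty$ for some $\delta\in(0,1)$; (iv) either $F$ vanishes on a neighborhood of $-\infty$, or $\overline F/\overline{M_{-1}F}$ has a positive finite limit at infinity and $h_-$ also satisfies (i) and (ii). Let $c_{(1)}$ be a weight that is maximal for $\preceq$, that is, one of the $c_i$ with $c_j\preceq c_{(1)}$ for all $j\in\mathbb Z$, and assume that $c_{(1)}\neq0$. Then for every integer $k$ with $1\le k\le m$, as $t\to\infty$, $$\overline G=\sum_{i\in\mathbb Z}\mathbb I\{c_i\succeq c_{(1)}e^{-k/\lambda}\}\,L_{G\natural M_{c_i}F,\;k+\lfloor\lambda\log|c_i/c_{(1)}|\rfloor}\,\overline{M_{c_i}F}+o\bigl(h^k\,\overline{M_{c_{(1)}}F}\bigr).$$ All the objects in this formula are well defined: $\sum_i c_iX_i$ converges absolutely almost surely, every $G\natural M_{c_i}F$ has finite moments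 of all orders, every $\overline{M_{c_i}F}$ is ultimately $m$ times continuously differentiable, and the sum over $i$ converges at all sufficiently large arguments. -/

import Mathlib

open Filter Topology Asymptotics MeasureTheory ProbabilityTheory

noncomputable section

namespace WeightedConvolution

/-- The tail `t ↦ 1 - F t` of the distribution `μ`. -/
def tail (μ : Measure ℝ) (t : ℝ) : ℝ := μ.real (Set.Ioi t)

/-- The hazard rate `F' / (1 - F)` of the distribution `μ`. -/
def hazardRate (μ : Measure ℝ) (t : ℝ) : ℝ := deriv (fun s => cdf μ s) t / tail μ t

/-- The multiplication operator: if `X` has law `μ` then `c * X` has law `mulLaw c μ`. -/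
def mulLaw (c : ℝ) (μ : Measure ℝ) : Measure ℝ := μ.map (fun x => c * x)

/-- Regular variation at infinity with index `ρ`. The function may be ultimately negative; taking
`x = 1` shows that it is ultimately nonzero. -/
def RegularlyVarying (f : ℝ → ℝ) (ρ : ℝ) : Prop :=
  ∀ x : ℝ, 0 < x → Tendsto (fun t => f (x * t) / f t) atTop (𝓝 (x ^ ρ))

/-- Smooth variation of index `α` and order `m`: ultimately `m` times continuously
differentiable, with an `m`-th derivative that is regularly varying of index `α - m`. -/
def SmoothlyVarying (h : ℝ → ℝ) (α : ℝ) (m : ℕ) : Prop :=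
  (∃ t₀ : ℝ, ContDiffOn ℝ m h (Set.Ioi t₀)) ∧ RegularlyVarying (iteratedDeriv m h) (α - m)

/-- Tail balance: the ratio of the upper tail to the lower tail has a positive finite limit. -/
def TailBalanced (μ : Measure ℝ) : Prop :=
  ∃ l : ℝ, 0 < l ∧ Tendsto (fun t => tail μ t / tail (mulLaw (-1) μ) t) atTop (𝓝 l)

/-- Strong tail balance relative to a property `p` that is imposed on the hazard rate of `μ`:
`μ` is tail balanced, and the hazard rate of the reflected distribution has the property too. -/
def StronglyTailBalanced (μ : Measure ℝ) (p : (ℝ → ℝ) → Prop) : Prop :=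
  TailBalanced μ ∧ p (hazardRate (mulLaw (-1) μ))

/-- The standard conditions on the weights and the distribution, relative to the property `p`
that is imposed on the hazard rate. -/
def StandardConditions (μ : Measure ℝ) (c : ℤ → ℝ) (p : (ℝ → ℝ) → Prop) : Prop :=
  (∃ δ : ℝ, 0 < δ ∧ δ < 1 ∧ Summable (fun i => |c i| ^ δ)) ∧
    ((∀ᶠ x in atBot, cdf μ x = 0) ∨ StronglyTailBalanced μ p)

/-- `a ≺ b`: the tail of `a X` is negligible with respect to that of `b X`. -/
def TailLT (μ : Measure ℝ) (a b : ℝ) : Prop :=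
  tail (mulLaw a μ) =o[atTop] tail (mulLaw b μ)

/-- `a ≡ b`: the tails of `a X` and `b X` are ultimately of the same order. -/
def TailEquiv (μ : Measure ℝ) (a b : ℝ) : Prop :=
  ∃ ε : ℝ, 0 < ε ∧ ∀ᶠ t in atTop,
    ε * tail (mulLaw a μ) t ≤ tail (mulLaw b μ) t ∧
      tail (mulLaw b μ) t ≤ ε⁻¹ * tail (mulLaw a μ) t

/-- `a ⪯ b`. -/
def TailLE (μ : Measure ℝ) (a b : ℝ) : Prop := TailLT μ a b ∨ TailEquiv μ a b

/-- The Laplace character of order `p` of the distribution `K`, applied to `f` at `t`: the sum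
over the integers `j` with `0 ≤ j ≤ p` of `(-1) ^ j / j!` times the `j`-th moment of `K` times the
`j`-th derivative of `f`. -/
def laplaceCharacter (K : Measure ℝ) (p : ℤ) (f : ℝ → ℝ) (t : ℝ) : ℝ :=
  ∑ j ∈ Finset.range (p + 1).toNat,
    (-1 : ℝ) ^ j / (j.factorial : ℝ) * (∫ x, x ^ j ∂K) * iteratedDeriv j f t

section Sums

variable {Ω : Type*} [MeasurableSpace Ω]

/-- The law of `∑ i, c i * X i`. -/
def sumLaw (P : Measure Ω) (X : ℤ → Ω → ℝ) (c : ℤ → ℝ) : Measure ℝ :=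
  P.map (fun ω => ∑' i, c i * X i ω)

/-- The law of the sum of `c j * X j` over all `j ≠ i`, that is, the law of the whole
weighted sum with the `i`-th factor of the convolution deleted. -/
def deletedLaw (P : Measure Ω) (X : ℤ → Ω → ℝ) (c : ℤ → ℝ) (i : ℤ) : Measure ℝ :=
  sumLaw P X (Function.update c i 0)

end Sums

end WeightedConvolution

end

/-!
Write `Q` for the tail of `μ` and `ℓ t = log t / t`. The hazard rate is of order `ℓ`, so that `Q`
is of lognormal type: `log Q` is close to `- lam / 2 * log ^ 2`. Hence a fixed rescaling of the
argument changes `Q` by a power of `t` only, while `Q` itself decreases faster than every power.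
This makes the single big jump heuristic precise with polynomial errors: two terms `c i * X i` of
order `t` have a joint probability which is smaller than any power of `1 / t` times the
reference tail, and a sum without a large term exceeds `t` with negligible probability too, by a
union bound for the terms with small weights (`measureReal_exists_small_weight_le`) and a Chernoff
bound with exponent `lam * log t ^ 2 / t` for the truncated terms
(`measureReal_exists_sum_truncated_gt_le`). By inclusion-exclusion the tail of the sum is, up to
such errors, the sum over the finitely many large weights of
`P (c i * X i + S i > t, c i * X i > t / 16)`, where `S i` is the sum of the other terms. Since
`S i` is independent of `X i`, this is the integral of `Q i (max (t - x) (t / 16))` with respect to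
the law of `S i`, with `Q i` the tail of `c i * X i`. That law has moments of all orders, and a
Taylor expansion of `Q i` on `|x| ≤ √t` turns the integral into the Laplace character
(`SmoothTail.integral_sub_laplaceCharacter_isBigO`).

The Taylor expansion requires `|Q⁽ʲ⁾| = O (ℓ ^ j * Q)` for `j ≤ m + 1`, one order more than is kept.
As `Q' = - h * Q`, this follows from `h⁽ʲ⁾ = O (ℓ t / t ^ j)` for `j ≤ m`. For `j = m`, regular
variation of `h⁽ᵐ⁾` and Baire's theorem show that `|h⁽ᵐ⁾|` at `t` is bounded by a multiple of its
values on an interval `[t, r * t]`, and on an interval of length `L` the `m`-th derivative of a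
function bounded by `B` has a value of order `B / L ^ m`; the other `j` follow by descending
induction (`SmoothlyVarying.iteratedDeriv_isBigO`).

All large weights are first expanded to the full order `k` (`tail_sumLaw_sub_sum_isBigO`). The tail
of `c i * X i` is smaller than the reference tail by about the power `lam * log |c i₀ / c i|` of
`1 / t`, and each derivative costs about one power more; the terms that the truncated characters
leave out are exactly those where the total power exceeds `k` (`laplaceCharacter_sub_isLittleO`).
If the lower tail of `μ` vanishes and all weights are nonpositive, the reference tail is ultimately
zero and both sides of the expansion vanish ultimately.
-/

noncomputable section

namespace WeightedConvolution

open Set Real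

/-! ### Iterated derivatives on a half line -/

lemma hasDerivAt_iteratedDeriv {f : ℝ → ℝ} {n j : ℕ} {t₀ x : ℝ}
    (hf : ContDiffOn ℝ n f (Ioi t₀)) (hj : j < n) (hx : t₀ < x) :
    HasDerivAt (iteratedDeriv j f) (iteratedDeriv (j + 1) f x) x := by
  have h1 : DifferentiableOn ℝ (iteratedDerivWithin j f (Ioi t₀)) (Ioi t₀) :=
    hf.differentiableOn_iteratedDerivWithin (by exact_mod_cast hj) (isOpen_Ioi.uniqueDiffOn)
  have h2 : DifferentiableOn ℝ (iteratedDeriv j f) (Ioi t₀) :=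
    h1.congr fun y hy => (iteratedDerivWithin_of_isOpen isOpen_Ioi hy).symm
  have h3 := (h2.differentiableAt (Ioi_mem_nhds hx)).hasDerivAt
  rwa [iteratedDeriv_succ]

lemma continuousOn_iteratedDeriv {f : ℝ → ℝ} {n j : ℕ} {t₀ : ℝ}
    (hf : ContDiffOn ℝ n f (Ioi t₀)) (hj : j ≤ n) :
    ContinuousOn (iteratedDeriv j f) (Ioi t₀) :=
  (hf.continuousOn_iteratedDerivWithin (by exact_mod_cast hj) (isOpen_Ioi.uniqueDiffOn)).congr
    fun _ hy => (iteratedDerivWithin_of_isOpen isOpen_Ioi hy).symm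

/-- No smoothness is needed: the junk values of both sides agree. -/
lemma iteratedDeriv_comp_div (f : ℝ → ℝ) (b : ℝ) (n : ℕ) (t : ℝ) :
    iteratedDeriv n (fun x => f (x / b)) t = b⁻¹ ^ n * iteratedDeriv n f (t / b) := by
  induction n generalizing t with
  | zero => simp
  | succ n ih =>
    have h : iteratedDeriv n (fun x => f (x / b))
        = fun t => b⁻¹ ^ n * iteratedDeriv n f (b⁻¹ * t) := by
      funext t; rw [ih, div_eq_inv_mul]
    rw [iteratedDeriv_succ, h, deriv_const_mul_field, deriv_comp_mul_left, iteratedDeriv_succ,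
      smul_eq_mul, div_eq_inv_mul]
    ring

/-- A function bounded by `B` on an interval of length `L` has a point there at which its `m`-th
derivative is at most a constant times `B / L ^ m`. -/
lemma exists_abs_iteratedDeriv_le (m : ℕ) : ∃ K : ℝ, 0 ≤ K ∧
    ∀ (f : ℝ → ℝ) (t₀ a L B : ℝ), ContDiffOn ℝ m f (Ioi t₀) → t₀ < a → 0 < L →
      (∀ x ∈ Icc a (a + L), |f x| ≤ B) →
      ∃ ξ ∈ Icc a (a + L), |iteratedDeriv m f ξ| ≤ K * B / L ^ m := by
  induction m with
  | zero =>
    refine ⟨1, zero_le_one, fun f t₀ a L B _ _ hL hB => ⟨a, ⟨le_rfl, by linarith⟩, ?_⟩⟩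
    simpa using hB a ⟨le_rfl, by linarith⟩
  | succ m ih =>
    -- apply the mean value theorem between good points of the outer thirds of the interval
    obtain ⟨K, hK, ih⟩ := ih
    refine ⟨2 * 3 ^ (m + 1) * K, by positivity, fun f t₀ a L B hf ha hL hB => ?_⟩
    have hf' : ContDiffOn ℝ m f (Ioi t₀) := hf.of_le (by exact_mod_cast Nat.le_succ m)
    obtain ⟨x, hx, hxb⟩ := ih f t₀ a (L / 3) B hf' ha (by positivity)
      (fun y hy => hB y ⟨hy.1, by linarith [hy.2]⟩)
    obtain ⟨y, hy, hyb⟩ := ih f t₀ (a + 2 * L / 3) (L / 3) B hf' (by linarith) (by positivity)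
      (fun y hy => hB y ⟨by linarith [hy.1], by linarith [hy.2]⟩)
    have hxy : L / 3 ≤ y - x := by linarith [hx.2, hy.1]
    have hlt : x < y := by linarith
    obtain ⟨ξ, hξ, hξe⟩ := exists_hasDerivAt_eq_slope (iteratedDeriv m f)
      (iteratedDeriv (m + 1) f) hlt
      (fun z hz => (hasDerivAt_iteratedDeriv hf (Nat.lt_succ_self m)
        (by linarith [hx.1, hz.1])).continuousAt.continuousWithinAt)
      (fun z hz => hasDerivAt_iteratedDeriv hf (Nat.lt_succ_self m) (by linarith [hx.1, hz.1]))
    refine ⟨ξ, ⟨by linarith [hx.1, hξ.1], by linarith [hy.2, hξ.2]⟩, ?_⟩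
    rw [hξe, abs_div, abs_of_pos (by linarith : 0 < y - x)]
    have hB0 : 0 ≤ B := (abs_nonneg _).trans (hB a ⟨le_rfl, by linarith⟩)
    calc |iteratedDeriv m f y - iteratedDeriv m f x| / (y - x)
        ≤ (K * B / (L / 3) ^ m + K * B / (L / 3) ^ m) / (L / 3) := by
          gcongr
          exact (abs_sub _ _).trans (add_le_add hyb hxb)
      _ = 2 * 3 ^ (m + 1) * K * B / L ^ (m + 1) := by
          rw [div_pow]
          field_simp
          ring

/-! ### Regular variation -/

/-- By Baire's theorem a continuous regularly varying function is comparable with its dilates by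
factors close to `1`, uniformly. -/
lemma RegularlyVarying.exists_abs_le {f : ℝ → ℝ} {ρ t₀ : ℝ} (hf : RegularlyVarying f ρ)
    (hc : ContinuousOn f (Ioi t₀)) :
    ∃ r > 1, ∃ C T : ℝ, ∀ t ≥ T, ∀ y ∈ Icc 1 r, |f t| ≤ C * |f (y * t)| := by
  have key : ∀ x : ℝ, 0 < x → ∀ᶠ t in atTop, f t ≠ 0 ∧
      |f (x * t)| ≤ (x ^ ρ + 1) * |f t| ∧ |f t| ≤ (2 / x ^ ρ) * |f (x * t)| := by
    intro x hx
    have hp : 0 < x ^ ρ := rpow_pos_of_pos hx ρ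
    have h1 : ∀ᶠ t in atTop, f t ≠ 0 := by
      have := hf 1 one_pos
      rw [one_rpow] at this
      filter_upwards [this.eventually (lt_mem_nhds (zero_lt_one))] with t ht h0
      simp [h0] at ht
    filter_upwards [h1, (hf x hx).eventually (lt_mem_nhds (half_lt_self hp)),
      (hf x hx).eventually (gt_mem_nhds (lt_add_one _))] with t h0 hl hu
    have h0' : 0 < |f t| := abs_pos.2 h0
    have e : |f (x * t) / f t| = f (x * t) / f t := abs_of_pos ((half_pos hp).trans hl)
    rw [← e, abs_div] at hl hu
    rw [lt_div_iff₀ h0'] at hl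
    rw [div_lt_iff₀ h0'] at hu
    refine ⟨h0, hu.le, ?_⟩
    rw [div_mul_eq_mul_div, le_div_iff₀ hp]
    linarith
  -- closed sets of dilation factors `1 + |y|` with a common bound; they cover the line
  set E : ℕ → Set ℝ := fun n =>
    {y | ∀ t : ℝ, |t₀| + 1 + n ≤ t → |f t| ≤ n * |f ((1 + |y|) * t)|} with hE
  have hclosed : ∀ n, IsClosed (E n) := by
    intro n
    simp only [hE, ofPred_forall]
    refine isClosed_iInter fun t => isClosed_iInter fun ht => ?_
    have h1 : Continuous fun y : ℝ => f ((1 + |y|) * t) := by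
      refine hc.comp_continuous (by fun_prop) fun y => ?_
      have h3 : t₀ < t := by
        have := le_abs_self t₀
        have : (0 : ℝ) ≤ n := n.cast_nonneg
        linarith
      have h4 : 0 ≤ t := by
        have := abs_nonneg t₀
        have : (0 : ℝ) ≤ n := n.cast_nonneg
        linarith
      have := mul_nonneg (abs_nonneg y) h4
      simp only [mem_Ioi]
      nlinarith
    exact isClosed_le continuous_const (continuous_const.mul h1.abs)
  have hcover : ⋃ n, E n = univ := by
    refine eq_univ_of_forall fun y => ?_
    obtain ⟨T, hT⟩ := eventually_atTop.1 (key (1 + |y|) (by positivity))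
    obtain ⟨n, hn⟩ := exists_nat_ge (max T (2 / (1 + |y|) ^ ρ))
    refine mem_iUnion.2 ⟨n, fun t ht => ?_⟩
    have h1 : T ≤ t := by
      have := le_max_left T (2 / (1 + |y|) ^ ρ)
      have := abs_nonneg t₀
      linarith
    refine (hT t h1).2.2.trans ?_
    gcongr
    exact (le_max_right _ _).trans hn
  obtain ⟨n, z, hz⟩ := nonempty_interior_of_iUnion_of_closed hclosed hcover
  obtain ⟨ε, hε, hball⟩ := Metric.isOpen_iff.1 isOpen_interior z hz
  -- an interval `[p, q]` of good dilation factors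
  have hgood : ∀ s ∈ Icc (0 : ℝ) (ε / 2), |z| + s ∈ E n ∨ -(|z| + s) ∈ E n := by
    intro s hs
    rcases le_total 0 z with h | h
    · left
      refine interior_subset (hball ?_)
      rw [abs_of_nonneg h, Metric.mem_ball, Real.dist_eq]
      rw [add_sub_cancel_left, abs_of_nonneg hs.1]
      linarith [hs.2]
    · right
      refine interior_subset (hball ?_)
      rw [abs_of_nonpos h, Metric.mem_ball, Real.dist_eq]
      rw [show -(-z + s) - z = -s by ring, abs_neg, abs_of_nonneg hs.1]
      linarith [hs.2]
  set p : ℝ := 1 + |z| with hp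
  have hp1 : 1 ≤ p := by have := abs_nonneg z; linarith
  have hgood' : ∀ x ∈ Icc p (p + ε / 2), ∀ t : ℝ, |t₀| + 1 + n ≤ t → |f t| ≤ n * |f (x * t)| := by
    intro x hx t ht
    have hs := hgood (x - p) ⟨by linarith [hx.1], by linarith [hx.2]⟩
    have hnn : 0 ≤ |z| + (x - p) := by have := abs_nonneg z; linarith [hx.1]
    have hx' : 1 + (|z| + (x - p)) = x := by rw [hp]; ring
    rcases hs with hs | hs
    · have := hs t ht
      rwa [abs_of_nonneg hnn, hx'] at this
    · have := hs t ht
      rwa [abs_neg, abs_of_nonneg hnn, hx'] at this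
  obtain ⟨T, hT⟩ := eventually_atTop.1 (key p (by linarith))
  refine ⟨(p + ε / 2) / p, ?_, n * (p ^ ρ + 1), max (max T 0) (|t₀| + 1 + n), fun t ht y hy => ?_⟩
  · rw [gt_iff_lt, lt_div_iff₀ (by linarith)]
    linarith
  have ht0 : 0 ≤ t := (le_max_right _ _).trans ((le_max_left _ _).trans ht)
  have htT : T ≤ y * t := by
    have : T ≤ t := (le_max_left _ _).trans ((le_max_left _ _).trans ht)
    nlinarith [hy.1]
  -- compare `f t` with `f (p * y * t)`, and this with `f (y * t)` by dilation by `p`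
  have h1 := hgood' (p * y) ⟨by nlinarith [hy.1], by
    have := hy.2
    rw [le_div_iff₀ (by linarith)] at this
    linarith⟩ t ((le_max_right _ _).trans ht)
  have h2 := (hT (y * t) htT).2.1
  rw [← mul_assoc] at h2
  calc |f t| ≤ n * |f (p * y * t)| := h1
    _ ≤ n * ((p ^ ρ + 1) * |f (y * t)|) := by gcongr
    _ = _ := by ring

/-! ### Derivatives of the hazard rate and of the tail -/

/-- The rate `log t / t`, to which hazard rates of lognormal type are proportional. -/
def logRate (t : ℝ) : ℝ := Real.log t / t

lemma logRate_nonneg {t : ℝ} (ht : 1 ≤ t) : 0 ≤ logRate t :=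
  div_nonneg (Real.log_nonneg ht) (by linarith)

lemma logRate_le {s t : ℝ} (hs : exp 1 ≤ s) (hst : s ≤ t) : logRate t ≤ logRate s :=
  Real.log_div_self_antitoneOn hs (hs.trans hst) hst

lemma logRate_le_one {t : ℝ} (ht : 0 < t) : logRate t ≤ 1 := by
  rw [logRate, div_le_one ht]
  linarith [Real.log_le_sub_one_of_pos ht]

lemma logRate_half_le {t : ℝ} (ht : 1 ≤ t) : logRate (t / 2) ≤ 2 * logRate t := by
  have h0 : 0 < t := by linarith
  rw [logRate, logRate, div_div_eq_mul_div, mul_comm, mul_div_assoc]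
  gcongr
  linarith

/-- Interpolation between a function of order `log t / t` and its regularly varying `m`-th
derivative. -/
lemma SmoothlyVarying.iteratedDeriv_isBigO {h : ℝ → ℝ} {α : ℝ} {m : ℕ}
    (hs : SmoothlyVarying h α m) (hO : h =O[atTop] logRate) {j : ℕ} (hj : j ≤ m) :
    iteratedDeriv j h =O[atTop] fun t => logRate t / t ^ j := by
  obtain ⟨⟨t₀, hc⟩, hrv⟩ := hs
  obtain ⟨C, hC⟩ := hO.bound
  obtain ⟨T, hT⟩ := eventually_atTop.1 hC
  set T₁ : ℝ := max (max T (t₀ + 1)) (exp 1) with hT₁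
  have hTT : T ≤ T₁ := (le_max_left _ _).trans (le_max_left _ _)
  have htT : t₀ < T₁ := by
    have : t₀ + 1 ≤ T₁ := (le_max_right _ _).trans (le_max_left _ _)
    linarith
  have heT : exp 1 ≤ T₁ := le_max_right _ _
  have he1 : (1 : ℝ) ≤ exp 1 := by
    have := add_one_le_exp (1 : ℝ)
    linarith
  have hsup : ∀ t ≥ T₁, ∀ x ≥ t, |h x| ≤ |C| * logRate t := by
    intro t ht x hx
    have h1 := hT x (by linarith)
    rw [norm_eq_abs, norm_eq_abs, abs_of_nonneg (logRate_nonneg (by linarith))] at h1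
    refine h1.trans ?_
    have := logRate_le (heT.trans ht) hx
    have h0 : 0 ≤ logRate x := logRate_nonneg (by linarith)
    exact mul_le_mul (le_abs_self _) this h0 (abs_nonneg _)
  -- descending induction on the order of the derivative
  suffices H : ∀ d ≤ m, iteratedDeriv (m - d) h =O[atTop] fun t => logRate t / t ^ (m - d) by
    have := H (m - j) (Nat.sub_le _ _)
    rwa [Nat.sub_sub_self hj] at this
  intro d
  induction d with
  | zero =>
    intro _
    rw [Nat.sub_zero]
    obtain ⟨r, hr, C₁, T₂, hRV⟩ := hrv.exists_abs_le (continuousOn_iteratedDeriv hc le_rfl)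
    obtain ⟨K, hK, hland⟩ := exists_abs_iteratedDeriv_le m
    refine IsBigO.of_bound (|C₁| * (K * |C| / (r - 1) ^ m)) ?_
    filter_upwards [eventually_ge_atTop T₁, eventually_ge_atTop T₂] with t h1 h2
    have ht0 : 0 < t := by linarith
    have hr0 : 0 < r - 1 := by linarith
    obtain ⟨ξ, hξ, hb⟩ := hland h t₀ t ((r - 1) * t) (|C| * logRate t) hc (by linarith)
      (by positivity) (fun x hx => hsup t h1 x hx.1)
    have h3 := hRV t h2 (ξ / t) ⟨by rw [le_div_iff₀ ht0]; linarith [hξ.1],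
      by rw [div_le_iff₀ ht0]; linarith [hξ.2]⟩
    rw [div_mul_cancel₀ _ ht0.ne'] at h3
    rw [norm_eq_abs, norm_eq_abs, abs_of_nonneg
      (div_nonneg (logRate_nonneg (by linarith)) (by positivity))]
    calc |iteratedDeriv m h t| ≤ C₁ * |iteratedDeriv m h ξ| := h3
      _ ≤ |C₁| * |iteratedDeriv m h ξ| := by gcongr; exact le_abs_self _
      _ ≤ |C₁| * (K * (|C| * logRate t) / ((r - 1) * t) ^ m) := by gcongr
      _ = _ := by rw [mul_pow]; field_simp
  | succ d ih =>
    intro hd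
    have ih := ih (by omega)
    obtain ⟨i, hi⟩ : ∃ i, i = m - (d + 1) := ⟨_, rfl⟩
    rw [← hi]
    rw [show m - d = i + 1 by omega] at ih
    obtain ⟨C₂, hC₂⟩ := ih.bound
    obtain ⟨T₂, hT₂⟩ := eventually_atTop.1 hC₂
    obtain ⟨K, hK, hland⟩ := exists_abs_iteratedDeriv_le i
    refine IsBigO.of_bound (K * |C| + |C₂|) ?_
    filter_upwards [eventually_ge_atTop T₁, eventually_ge_atTop T₂] with t h1 h2
    have ht0 : 0 < t := by linarith
    have hl0 : 0 ≤ logRate t := logRate_nonneg (by linarith)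
    obtain ⟨ξ, hξ, hb⟩ := hland h t₀ t t (|C| * logRate t)
      (hc.of_le (by exact_mod_cast (by omega : i ≤ m))) (by linarith)
      (by positivity) (fun x hx => hsup t h1 x hx.1)
    have hmv := (convex_Icc t (t + t)).norm_image_sub_le_of_norm_hasDerivWithin_le
      (f := iteratedDeriv i h) (f' := iteratedDeriv (i + 1) h)
      (C := |C₂| * (logRate t / t ^ (i + 1))) (x := ξ) (y := t)
      (fun x hx => (hasDerivAt_iteratedDeriv hc (by omega)
        (by linarith [hx.1])).hasDerivWithinAt)
      (fun x hx => by
        have h4 := hT₂ x (by linarith [hx.1])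
        have hx0 : 0 < x := by linarith [hx.1]
        have hlx : 0 ≤ logRate x := logRate_nonneg (by linarith [hx.1])
        rw [norm_eq_abs (_ / _), abs_of_nonneg (div_nonneg hlx (by positivity))] at h4
        refine h4.trans ?_
        gcongr
        · exact le_abs_self _
        · exact logRate_le (heT.trans h1) hx.1
        · exact hx.1) hξ ⟨le_rfl, by linarith⟩
    rw [norm_eq_abs, norm_eq_abs] at hmv
    rw [norm_eq_abs, norm_eq_abs, abs_of_nonneg (div_nonneg hl0 (by positivity))]
    have hd1 : |t - ξ| ≤ t := by
      rw [abs_le]; constructor <;> linarith [hξ.1, hξ.2]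
    calc |iteratedDeriv i h t|
        = |iteratedDeriv i h ξ + (iteratedDeriv i h t - iteratedDeriv i h ξ)| := by congr 1; ring
      _ ≤ |iteratedDeriv i h ξ| + |iteratedDeriv i h t - iteratedDeriv i h ξ| := abs_add_le _ _
      _ ≤ K * (|C| * logRate t) / t ^ i + |C₂| * (logRate t / t ^ (i + 1)) * t := by
          refine add_le_add hb (hmv.trans ?_)
          gcongr
      _ = _ := by
          rw [pow_succ]
          field_simp

lemma logRate_div_pow_isBigO (j : ℕ) :
    (fun t => logRate t / t ^ j) =O[atTop] fun t => logRate t ^ (j + 1) := by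
  refine IsBigO.of_bound 1 ?_
  filter_upwards [eventually_ge_atTop (exp 1)] with t ht
  have h0 : 0 < t := (exp_pos 1).trans_le ht
  have h1 : 1 ≤ log t := by rwa [le_log_iff_exp_le h0]
  have h2 : 0 ≤ logRate t := div_nonneg (by linarith) h0.le
  rw [one_mul, norm_of_nonneg (by positivity), norm_of_nonneg (by positivity), pow_succ',
    div_eq_mul_one_div]
  gcongr
  rw [logRate, div_pow]
  gcongr
  exact one_le_pow₀ h1

/-- A nonnegative nonincreasing function which is ultimately `n` times continuously differentiable,
each differentiation costing at most a factor of order `log t / t`. Ultimately vanishing tails are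
included. -/
structure SmoothTail (Q : ℝ → ℝ) (n : ℕ) : Prop where
  antitone : Antitone Q
  nonneg : ∀ t, 0 ≤ Q t
  contDiffOn : ∃ t₀, ContDiffOn ℝ n Q (Ioi t₀)
  isBigO : ∀ j ≤ n, iteratedDeriv j Q =O[atTop] fun t => logRate t ^ j * Q t

lemma tail_antitone (μ : Measure ℝ) [IsFiniteMeasure μ] : Antitone (tail μ) := fun _ _ h =>
  measureReal_mono (Ioi_subset_Ioi h)

lemma tail_nonneg (μ : Measure ℝ) (t : ℝ) : 0 ≤ tail μ t := measureReal_nonneg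

lemma tail_eq_one_sub_cdf (μ : Measure ℝ) [IsProbabilityMeasure μ] (t : ℝ) :
    tail μ t = 1 - cdf μ t := by
  rw [cdf_eq_real, tail, ← compl_Iic, probReal_compl_eq_one_sub measurableSet_Iic]

/-- A hazard rate of order `log t / t` is nonzero, which forces the tail to be positive and
differentiable: the junk values of division and differentiation are excluded. -/
lemma exists_hasDerivAt_tail (μ : Measure ℝ) [IsProbabilityMeasure μ] {lam : ℝ} (hlam : 0 < lam)
    (hi : hazardRate μ ~[atTop] fun t => lam * t⁻¹ * Real.log t) :
    ∃ t₀ : ℝ, ∀ t > t₀, 0 < tail μ t ∧ HasDerivAt (tail μ) (-(hazardRate μ t * tail μ t)) t := by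
  have h1 : ∀ᶠ t in atTop, hazardRate μ t ≠ 0 := by
    obtain ⟨u, hu, h⟩ := hi.exists_eq_mul
    filter_upwards [hu.eventually (lt_mem_nhds zero_lt_one), h, eventually_gt_atTop 1]
      with t h1 h2 h3
    have h4 := Real.log_pos h3
    rw [h2, Pi.mul_apply]
    have : 0 < t := by linarith
    positivity
  obtain ⟨t₀, ht₀⟩ := eventually_atTop.1 h1
  refine ⟨t₀, fun t ht => ?_⟩
  have hne := ht₀ t ht.le
  rw [hazardRate, div_ne_zero_iff] at hne
  refine ⟨lt_of_le_of_ne (tail_nonneg μ t) hne.2.symm, ?_⟩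
  have hd : DifferentiableAt ℝ (fun s => cdf μ s) t := differentiableAt_of_deriv_ne_zero hne.1
  rw [hazardRate, div_mul_cancel₀ _ hne.2]
  have : tail μ = fun s => 1 - cdf μ s := funext (tail_eq_one_sub_cdf μ)
  rw [this]
  exact hd.hasDerivAt.const_sub 1

lemma hazardRate_isBigO {h : ℝ → ℝ} {lam : ℝ}
    (hi : h ~[atTop] fun t => lam * t⁻¹ * Real.log t) : h =O[atTop] logRate := by
  refine hi.isBigO.trans ?_
  have : (fun t : ℝ => lam * t⁻¹ * Real.log t) = fun t => lam * logRate t := by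
    funext t; rw [logRate]; ring
  rw [this]
  exact (isBigO_refl _ _).const_mul_left _

lemma contDiffOn_of_hasDerivAt_mul {Q h : ℝ → ℝ} {t₀ : ℝ} {m : ℕ}
    (hQ : ∀ t > t₀, HasDerivAt Q (-(h t * Q t)) t) (hh : ContDiffOn ℝ m h (Ioi t₀)) {n : ℕ}
    (hn : n ≤ m + 1) : ContDiffOn ℝ n Q (Ioi t₀) := by
  induction n with
  | zero =>
    simp only [Nat.cast_zero, contDiffOn_zero]
    exact fun t ht => (hQ t ht).continuousAt.continuousWithinAt
  | succ n ih =>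
    rw [Nat.cast_succ, contDiffOn_succ_iff_deriv_of_isOpen isOpen_Ioi]
    refine ⟨fun t ht => (hQ t ht).differentiableAt.differentiableWithinAt, by simp, ?_⟩
    have h1 : ContDiffOn ℝ n (fun t => -(h t * Q t)) (Ioi t₀) :=
      ((hh.of_le (by exact_mod_cast (by omega : n ≤ m))).mul (ih (by omega))).neg
    exact h1.congr fun t ht => (hQ t ht).deriv

/-- One derivative is gained over the hazard rate, by Leibniz' formula for `Q' = - h * Q`. -/
lemma smoothTail_tail (μ : Measure ℝ) [IsProbabilityMeasure μ] {lam : ℝ} (hlam : 0 < lam)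
    {m : ℕ} (hi : hazardRate μ ~[atTop] fun t => lam * t⁻¹ * Real.log t)
    (hii : SmoothlyVarying (hazardRate μ) (-1) m) : SmoothTail (tail μ) (m + 1) := by
  obtain ⟨t₁, ht₁⟩ := exists_hasDerivAt_tail μ hlam hi
  have hder := hii
  obtain ⟨⟨t₂, hc⟩, -⟩ := hii
  set t₀ := max t₁ t₂ with ht₀
  have hQ : ∀ t > t₀, HasDerivAt (tail μ) (-(hazardRate μ t * tail μ t)) t :=
    fun t ht => (ht₁ t ((le_max_left _ _).trans_lt ht)).2
  have hh : ContDiffOn ℝ m (hazardRate μ) (Ioi t₀) :=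
    hc.mono (Ioi_subset_Ioi (le_max_right _ _))
  refine ⟨tail_antitone μ, tail_nonneg μ,
    ⟨t₀, contDiffOn_of_hasDerivAt_mul hQ hh le_rfl⟩, ?_⟩
  intro j
  induction j using Nat.strong_induction_on with
  | _ j ih =>
    intro hj
    cases j with
    | zero => simpa using isBigO_refl _ _
    | succ j =>
      have hEq : iteratedDeriv (j + 1) (tail μ) =ᶠ[atTop] fun t =>
          -∑ i ∈ Finset.range (j + 1), (j.choose i : ℝ) * iteratedDeriv i (hazardRate μ) t
            * iteratedDeriv (j - i) (tail μ) t := by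
        filter_upwards [eventually_gt_atTop t₀] with t ht
        have hev : deriv (tail μ) =ᶠ[𝓝 t] fun s => -(hazardRate μ * tail μ) s := by
          filter_upwards [Ioi_mem_nhds ht] with s hs
          exact (hQ s hs).deriv
        rw [iteratedDeriv_succ', hev.iteratedDeriv_eq, iteratedDeriv_fun_neg]
        rw [iteratedDeriv_mul]
        · exact ((hh.of_le (by exact_mod_cast (by omega : j ≤ m))).contDiffAt
            (Ioi_mem_nhds ht))
        · exact ((contDiffOn_of_hasDerivAt_mul hQ hh (by omega : j ≤ m + 1)).contDiffAt
            (Ioi_mem_nhds ht))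
      refine hEq.trans_isBigO (IsBigO.neg_left (IsBigO.fun_sum fun i hi => ?_))
      have hij : i ≤ j := by simpa [Nat.lt_succ_iff] using hi
      have h1 : iteratedDeriv i (hazardRate μ) =O[atTop] fun t => logRate t ^ (i + 1) :=
        (hder.iteratedDeriv_isBigO (hazardRate_isBigO ‹_›) (by omega)).trans
          (logRate_div_pow_isBigO i)
      have h2 := ih (j - i) (by omega) (by omega)
      refine ((h1.const_mul_left (j.choose i : ℝ)).mul h2).congr_right fun t => ?_
      rw [← mul_assoc, ← pow_add]
      congr 2
      omega

lemma SmoothTail.of_le {Q : ℝ → ℝ} {n k : ℕ} (hQ : SmoothTail Q n) (hk : k ≤ n) :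
    SmoothTail Q k :=
  ⟨hQ.antitone, hQ.nonneg, hQ.contDiffOn.imp fun _ h => h.of_le (by exact_mod_cast hk),
    fun j hj => hQ.isBigO j (hj.trans hk)⟩

lemma logRate_div_isBigO {b : ℝ} (hb : 0 < b) : (fun t => logRate (t / b)) =O[atTop] logRate := by
  refine IsBigO.of_bound (2 * b) ?_
  filter_upwards [eventually_ge_atTop (max 1 b), eventually_ge_atTop b⁻¹] with t h1 h3
  have hb' : b ≤ t := (le_max_right _ _).trans h1
  have h1' : 1 ≤ t := (le_max_left _ _).trans h1
  have h2 : 1 ≤ t / b := by rwa [le_div_iff₀ hb, one_mul]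
  have ht : 0 < t := by linarith
  rw [norm_of_nonneg (logRate_nonneg h2), norm_of_nonneg (logRate_nonneg h1'), logRate, logRate,
    Real.log_div ht.ne' hb.ne']
  have h4 : -log b ≤ log t := by
    rw [← Real.log_inv]
    exact Real.log_le_log (by positivity) h3
  rw [div_div_eq_mul_div, mul_div_assoc', div_le_div_iff_of_pos_right ht]
  nlinarith

lemma SmoothTail.comp_div {Q : ℝ → ℝ} {n : ℕ} (hQ : SmoothTail Q n) {b : ℝ} (hb : 0 < b) :
    SmoothTail (fun t => Q (t / b)) n := by
  refine ⟨fun s t h => hQ.antitone (by gcongr), fun t => hQ.nonneg _, ?_, fun j hj => ?_⟩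
  · obtain ⟨t₀, h⟩ := hQ.contDiffOn
    refine ⟨b * t₀, h.comp (contDiff_id.div_const b).contDiffOn fun t ht => ?_⟩
    rw [mem_Ioi] at ht
    simp only [mem_Ioi]
    rwa [lt_div_iff₀ hb, mul_comm]
  · have h1 : (fun t => iteratedDeriv j Q (t / b)) =O[atTop]
        fun t => logRate (t / b) ^ j * Q (t / b) :=
      (hQ.isBigO j hj).comp_tendsto (tendsto_id.atTop_div_const hb)
    have h2 : (fun t => logRate (t / b) ^ j * Q (t / b)) =O[atTop]
        fun t => logRate t ^ j * Q (t / b) :=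
      ((logRate_div_isBigO hb).pow j).mul (isBigO_refl _ _)
    exact ((h1.trans h2).const_mul_left (b⁻¹ ^ j)).congr_left
      fun t => (iteratedDeriv_comp_div Q b j t).symm

lemma iteratedDeriv_eventuallyEq_zero {Q : ℝ → ℝ} (h : Q =ᶠ[atTop] 0) (j : ℕ) :
    iteratedDeriv j Q =ᶠ[atTop] 0 := by
  obtain ⟨T, hT⟩ := eventually_atTop.1 h
  filter_upwards [eventually_gt_atTop T] with t ht
  have : Q =ᶠ[𝓝 t] fun _ => 0 := by
    filter_upwards [Ioi_mem_nhds ht] with s hs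
    exact hT s hs.le
  rw [this.iteratedDeriv_eq]
  simp

lemma smoothTail_of_eventuallyEq_zero {Q : ℝ → ℝ} (ha : Antitone Q) (h0 : ∀ t, 0 ≤ Q t)
    (h : Q =ᶠ[atTop] 0) (n : ℕ) : SmoothTail Q n := by
  refine ⟨ha, h0, ?_, fun j _ => ?_⟩
  · obtain ⟨T, hT⟩ := eventually_atTop.1 h
    exact ⟨T, contDiffOn_const (c := (0 : ℝ)) |>.congr fun t ht => hT t (le_of_lt ht)⟩
  · refine (iteratedDeriv_eventuallyEq_zero h j).trans_isBigO ?_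
    exact isBigO_zero _ _

/-! ### Comparison of a tail at different arguments -/

lemma hasDerivAt_exp_log_sq (C : ℝ) {t : ℝ} (ht : 0 < t) :
    HasDerivAt (fun t => exp (C / 2 * log t ^ 2)) (exp (C / 2 * log t ^ 2) * (C * logRate t)) t := by
  have h := (((Real.hasDerivAt_log ht.ne').pow 2).const_mul (C / 2)).exp
  refine h.congr_deriv ?_
  simp only [logRate, Pi.pow_apply]
  push_cast
  field_simp

/-- Gronwall: `|Q'| ≤ C (log t / t) Q` makes `Q * exp (C / 2 * log ^ 2)` nondecreasing. -/
lemma le_mul_exp_of_hasDerivAt {Q Q' : ℝ → ℝ} {C T : ℝ} (hT : 0 < T)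
    (hd : ∀ t ≥ T, HasDerivAt Q (Q' t) t) (hb : ∀ t ≥ T, -(C * logRate t * Q t) ≤ Q' t)
    {s t : ℝ} (hs : T ≤ s) (hst : s ≤ t) :
    Q s ≤ Q t * exp (C / 2 * (log t ^ 2 - log s ^ 2)) := by
  have hder : ∀ t ≥ T, HasDerivAt (fun t => Q t * exp (C / 2 * log t ^ 2))
      (Q' t * exp (C / 2 * log t ^ 2) + Q t * (exp (C / 2 * log t ^ 2) * (C * logRate t))) t :=
    fun t ht => (hd t ht).mul (hasDerivAt_exp_log_sq C (hT.trans_le ht))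
  have hmono : MonotoneOn (fun t => Q t * exp (C / 2 * log t ^ 2)) (Ici T) := by
    refine monotoneOn_of_deriv_nonneg (convex_Ici T)
      (fun t ht => (hder t ht).continuousAt.continuousWithinAt)
      (fun t ht => (hder t (interior_subset ht)).differentiableAt.differentiableWithinAt)
      fun t ht => ?_
    have ht' : T ≤ t := interior_subset ht
    rw [(hder t ht').deriv]
    have := hb t ht'
    have he := exp_pos (C / 2 * log t ^ 2)
    nlinarith
  have h := hmono hs (hs.trans hst) hst
  simp only at h
  rw [mul_sub, exp_sub, mul_div_assoc', le_div_iff₀ (exp_pos _)]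
  exact h

lemma mul_exp_le_of_hasDerivAt {Q Q' : ℝ → ℝ} {C T : ℝ} (hT : 0 < T)
    (hd : ∀ t ≥ T, HasDerivAt Q (Q' t) t) (hb : ∀ t ≥ T, Q' t ≤ -(C * logRate t * Q t))
    {s t : ℝ} (hs : T ≤ s) (hst : s ≤ t) :
    Q t * exp (C / 2 * (log t ^ 2 - log s ^ 2)) ≤ Q s := by
  have := le_mul_exp_of_hasDerivAt (Q := fun t => -Q t) (Q' := fun t => -Q' t) (C := C) hT
    (fun t ht => (hd t ht).neg) (fun t ht => by have := hb t ht; linarith) hs hst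
  linarith

lemma SmoothTail.exists_le_mul_exp {Q : ℝ → ℝ} {n : ℕ} (hQ : SmoothTail Q n) (hn : 1 ≤ n) :
    ∃ C ≥ 0, ∃ T ≥ 1, ∀ s t : ℝ, T ≤ s → s ≤ t →
      Q s ≤ Q t * exp (C / 2 * (log t ^ 2 - log s ^ 2)) := by
  obtain ⟨C, hC⟩ := (hQ.isBigO 1 hn).bound
  obtain ⟨T, hT⟩ := eventually_atTop.1 hC
  obtain ⟨t₀, hc⟩ := hQ.contDiffOn
  refine ⟨|C|, abs_nonneg C, max (max T (t₀ + 1)) 1, le_max_right _ _, fun s t hs hst => ?_⟩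
  refine le_mul_exp_of_hasDerivAt (Q' := iteratedDeriv 1 Q)
    (lt_of_lt_of_le one_pos (le_max_right _ _)) (fun t ht => ?_) (fun t ht => ?_) hs hst
  · have h1 : t₀ + 1 ≤ t := (le_max_right _ _).trans ((le_max_left _ _).trans ht)
    have := hasDerivAt_iteratedDeriv hc (j := 0) hn (by linarith : t₀ < t)
    simpa using this
  · have h1 : 1 ≤ t := (le_max_right _ _).trans ht
    have h2 := hT t ((le_max_left _ _).trans ((le_max_left _ _).trans ht))
    have h3 : 0 ≤ logRate t * Q t := mul_nonneg (logRate_nonneg h1) (hQ.nonneg t)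
    rw [pow_one, norm_eq_abs, norm_of_nonneg h3] at h2
    have h4 := neg_abs_le (iteratedDeriv 1 Q t)
    have h5 := mul_le_mul_of_nonneg_right (le_abs_self C) h3
    linarith

/-- A fixed rescaling of the argument costs at most a power of `t`. -/
lemma SmoothTail.exists_comp_mul_le {Q : ℝ → ℝ} {n : ℕ} (hQ : SmoothTail Q n) (hn : 1 ≤ n)
    {θ : ℝ} (h0 : 0 < θ) (h1 : θ ≤ 1) :
    ∃ N : ℕ, ∀ᶠ t in atTop, Q (θ * t) ≤ t ^ N * Q t := by
  obtain ⟨C, hC, T, hT, h⟩ := hQ.exists_le_mul_exp hn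
  obtain ⟨N, hN⟩ := exists_nat_ge (C * log θ⁻¹)
  refine ⟨N, ?_⟩
  filter_upwards [eventually_ge_atTop (T / θ), eventually_ge_atTop 1] with t ht ht1
  have ht0 : 0 < t := by linarith
  have hl0 : 0 ≤ log t := log_nonneg ht1
  have hlθ : 0 ≤ log θ⁻¹ := log_nonneg ((one_le_inv₀ h0).2 h1)
  have h2 := h (θ * t) t (by rwa [div_le_iff₀' h0] at ht) (by nlinarith)
  refine h2.trans ?_
  rw [mul_comm]
  refine mul_le_mul_of_nonneg_right ?_ (hQ.nonneg t)
  rw [log_mul h0.ne' ht0.ne', ← exp_log (pow_pos ht0 N), exp_le_exp, log_pow]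
  rw [log_inv] at hN hlθ
  have h3 : C / 2 * (log t ^ 2 - (log θ + log t) ^ 2) ≤ C * (-log θ) * log t := by
    nlinarith [mul_nonneg hC (sq_nonneg (log θ))]
  exact h3.trans (by gcongr)

lemma SmoothTail.exists_sub_sqrt_le {Q : ℝ → ℝ} {n : ℕ} (hQ : SmoothTail Q n) (hn : 1 ≤ n) :
    ∃ C ≥ 0, ∀ᶠ t in atTop, Q (t - √t) ≤ C * Q t := by
  obtain ⟨C, hC, T, hT, h⟩ := hQ.exists_le_mul_exp hn
  refine ⟨exp (C / 2 * 8), (exp_pos _).le, ?_⟩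
  filter_upwards [eventually_ge_atTop (2 * T), eventually_ge_atTop 4] with t ht ht1
  have ht0 : 0 < t := by linarith
  have hsq : √t * √t = t := mul_self_sqrt ht0.le
  have hs2 : 2 ≤ √t := by
    rw [show (2 : ℝ) = √4 by rw [show (4 : ℝ) = 2 ^ 2 by norm_num, sqrt_sq zero_le_two]]
    exact sqrt_le_sqrt ht1
  have hs0 : 0 < √t := by linarith
  have hhalf : t / 2 ≤ t - √t := by nlinarith
  have hpos : 0 < t - √t := by linarith
  have h2 := h (t - √t) t (by linarith) (by linarith)
  refine h2.trans ?_
  rw [mul_comm]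
  refine mul_le_mul_of_nonneg_right (exp_le_exp.2 ?_) (hQ.nonneg t)
  refine mul_le_mul_of_nonneg_left ?_ (by positivity)
  have h3 : log t - log (t - √t) ≤ 2 / √t := by
    rw [← log_div ht0.ne' hpos.ne']
    refine (log_le_sub_one_of_pos (by positivity)).trans ?_
    rw [div_sub_one hpos.ne', div_le_div_iff₀ hpos hs0]
    nlinarith
  have h4 : log t ≤ 2 * √t := by
    have : log t = 2 * log √t := by rw [log_sqrt ht0.le]; ring
    rw [this]
    have := log_le_sub_one_of_pos hs0
    linarith
  have h5 : log (t - √t) ≤ log t := log_le_log hpos (by linarith)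
  have h6 : 0 ≤ log (t - √t) := log_nonneg (by linarith)
  calc log t ^ 2 - log (t - √t) ^ 2
      = (log t - log (t - √t)) * (log t + log (t - √t)) := by ring
    _ ≤ 2 / √t * (4 * √t) := by
        refine mul_le_mul h3 (by linarith) (by linarith) (by positivity)
    _ = 8 := by field_simp; norm_num

/-! ### Laplace characters -/

lemma taylorWithinEval_eq_sum_iteratedDeriv {Q : ℝ → ℝ} {t₀ t s : ℝ} {k : ℕ}
    (hc : ContDiffOn ℝ k Q (Ioi t₀)) (ht : t₀ < t) (hne : t ≠ s) :
    taylorWithinEval Q k (uIcc t s) t s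
      = ∑ j ∈ Finset.range (k + 1), (s - t) ^ j / (j.factorial : ℝ) * iteratedDeriv j Q t := by
  rw [taylor_within_apply]
  refine Finset.sum_congr rfl fun j hj => ?_
  have hjk : j ≤ k := by simpa [Nat.lt_succ_iff] using hj
  have h1 : ContDiffAt ℝ j Q t :=
    (hc.of_le (by exact_mod_cast hjk)).contDiffAt (Ioi_mem_nhds ht)
  rw [iteratedDerivWithin_eq_iteratedDeriv (uniqueDiffOn_uIcc hne) h1 left_mem_uIcc, smul_eq_mul]
  ring

/-- The integrand of the Laplace character differs from `Q (max (t - x) (θ t))` by a Taylor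
remainder where `|x| ≤ √t`, and by a trivial bound times `(x ^ 2 / t) ^ N ≥ 1` elsewhere. -/
lemma SmoothTail.exists_taylor_bound {Q : ℝ → ℝ} {k : ℕ} (hQ : SmoothTail Q (k + 1))
    {θ : ℝ} (hθ : θ ≤ 1 / 2) (N : ℕ) : ∃ C ≥ 0, ∀ᶠ t in atTop, ∀ x : ℝ,
      |Q (max (t - x) (θ * t))
          - ∑ j ∈ Finset.range (k + 1), (-x) ^ j / (j.factorial : ℝ) * iteratedDeriv j Q t|
        ≤ C * (logRate t ^ (k + 1) * Q t) * |x| ^ (k + 1)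
          + C * (Q (θ * t) / t ^ N) * (|x| ^ (2 * N) * (1 + |x|) ^ k) := by
  obtain ⟨C₁, hC₁, h₁⟩ := hQ.exists_sub_sqrt_le (by omega)
  have h2 : ∃ C₂ ≥ 0, ∀ᶠ t in atTop, ∀ j ≤ k + 1,
      |iteratedDeriv j Q t| ≤ C₂ * (logRate t ^ j * Q t) := by
    have : ∀ j : ℕ, ∃ c ≥ 0, j ≤ k + 1 → ∀ᶠ t in atTop,
        |iteratedDeriv j Q t| ≤ c * (logRate t ^ j * Q t) := by
      intro j
      by_cases hj : j ≤ k + 1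
      · obtain ⟨c, hc, hb⟩ := (hQ.isBigO j hj).exists_nonneg
        refine ⟨c, hc, fun _ => ?_⟩
        filter_upwards [hb.bound, eventually_ge_atTop 1] with t ht ht1
        rwa [norm_eq_abs, norm_of_nonneg
          (mul_nonneg (pow_nonneg (logRate_nonneg ht1) j) (hQ.nonneg t))] at ht
      · exact ⟨0, le_rfl, fun h => absurd h hj⟩
    choose c hc hb using this
    refine ⟨∑ j ∈ Finset.range (k + 2), c j, Finset.sum_nonneg fun j _ => hc j, ?_⟩
    have : ∀ᶠ t in atTop, ∀ j ∈ Finset.range (k + 2),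
        |iteratedDeriv j Q t| ≤ c j * (logRate t ^ j * Q t) :=
      (Filter.eventually_all_finset _).2 fun j hj => hb j (by simp at hj; omega)
    filter_upwards [this, eventually_ge_atTop 1] with t ht ht1 j hj
    have hj' : j ∈ Finset.range (k + 2) := by simp; omega
    refine (ht j hj').trans (mul_le_mul_of_nonneg_right ?_
      (mul_nonneg (pow_nonneg (logRate_nonneg ht1) j) (hQ.nonneg t)))
    exact Finset.single_le_sum (fun i _ => hc i) hj'
  obtain ⟨C₂, hC₂, h₂⟩ := h2
  obtain ⟨t₀, hc⟩ := hQ.contDiffOn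
  obtain ⟨T, hT⟩ := eventually_atTop.1 h₂
  refine ⟨C₂ * 2 ^ (k + 1) * C₁ + (1 + C₂ * (k + 1)), by positivity, ?_⟩
  filter_upwards [h₁, h₂, eventually_ge_atTop (2 * T), eventually_gt_atTop (2 * t₀),
    eventually_ge_atTop (2 * exp 1), eventually_ge_atTop 4] with t ht₁ ht₂ htT ht0 hte ht4 x
  have htpos : 0 < t := by linarith
  have hl0 : 0 ≤ logRate t := logRate_nonneg (by linarith)
  have hQt := hQ.nonneg t
  have hQθ := hQ.nonneg (θ * t)
  have hsq : √t * √t = t := mul_self_sqrt htpos.le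
  have hs2 : 2 ≤ √t := by
    rw [show (2 : ℝ) = √4 by rw [show (4 : ℝ) = 2 ^ 2 by norm_num, sqrt_sq zero_le_two]]
    exact sqrt_le_sqrt ht4
  have hhalf : t / 2 ≤ t - √t := by nlinarith
  rcases le_or_gt |x| √t with hx | hx
  · refine le_trans ?_ (le_add_of_nonneg_right (by positivity))
    have hx1 := abs_le.1 hx
    have hmax : max (t - x) (θ * t) = t - x := by
      apply max_eq_left
      nlinarith
    rw [hmax]
    rcases eq_or_ne x 0 with rfl | hx0
    · have : ∑ j ∈ Finset.range (k + 1), (-0 : ℝ) ^ j / (j.factorial : ℝ) * iteratedDeriv j Q t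
          = Q t := by
        rw [Finset.sum_range_succ', Finset.sum_eq_zero]
        · simp
        · intro j _; simp
      rw [this]
      simp
    have hne : t ≠ t - x := by intro h; apply hx0; linarith
    have hlow : ∀ y ∈ uIcc t (t - x), t - √t ≤ y := by
      intro y hy
      have := hy.1
      rcases le_total t (t - x) with h | h
      · rw [inf_eq_left.2 h] at this; linarith
      · rw [inf_eq_right.2 h] at this; linarith
    obtain ⟨ξ, hξ, he⟩ := taylor_mean_remainder_lagrange_iteratedDeriv (f := Q) (n := k) hne
      (by
        have hsub : uIcc t (t - x) ⊆ Ioi t₀ := fun y hy => by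
          have := hlow y hy
          rw [mem_Ioi]
          linarith
        exact_mod_cast hc.mono hsub)
    rw [taylorWithinEval_eq_sum_iteratedDeriv (hc.of_le (by exact_mod_cast Nat.le_succ k))
      (by linarith : t₀ < t) hne] at he
    rw [show t - x - t = -x by ring] at he
    rw [he, abs_div, abs_mul, abs_pow, abs_neg, Nat.abs_cast]
    have hξl : t - √t ≤ ξ := hlow ξ ⟨hξ.1.le, hξ.2.le⟩
    have hD := hT ξ (by linarith) (k + 1) le_rfl
    have hlr : logRate ξ ≤ 2 * logRate t :=
      (logRate_le (by linarith) (by linarith : t / 2 ≤ ξ)).trans (logRate_half_le (by linarith))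
    have hlξ : 0 ≤ logRate ξ := logRate_nonneg (by linarith)
    have hQξ : Q ξ ≤ C₁ * Q t := (hQ.antitone hξl).trans ht₁
    have hfac : (1 : ℝ) ≤ ((k + 1).factorial : ℝ) := by
      exact_mod_cast Nat.succ_le_of_lt (Nat.factorial_pos _)
    calc |iteratedDeriv (k + 1) Q ξ| * |x| ^ (k + 1) / ↑(k + 1).factorial
        ≤ |iteratedDeriv (k + 1) Q ξ| * |x| ^ (k + 1) := div_le_self (by positivity) hfac
      _ ≤ C₂ * (logRate ξ ^ (k + 1) * Q ξ) * |x| ^ (k + 1) := by gcongr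
      _ ≤ C₂ * ((2 * logRate t) ^ (k + 1) * (C₁ * Q t)) * |x| ^ (k + 1) := by
          gcongr
          exact hQ.nonneg _
      _ = C₂ * 2 ^ (k + 1) * C₁ * (logRate t ^ (k + 1) * Q t) * |x| ^ (k + 1) := by
          rw [mul_pow]; ring
      _ ≤ _ := by
          refine mul_le_mul_of_nonneg_right (mul_le_mul_of_nonneg_right ?_ (by positivity))
            (by positivity)
          linarith [(by positivity : (0 : ℝ) ≤ 1 + C₂ * (k + 1))]
  · refine le_trans ?_ (le_add_of_nonneg_left (by positivity))
    have hx2 : t ≤ |x| ^ 2 := by nlinarith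
    have hratio : 1 ≤ |x| ^ (2 * N) / t ^ N := by
      rw [le_div_iff₀ (by positivity), one_mul, pow_mul]
      gcongr
    have hQθt : Q t ≤ Q (θ * t) := hQ.antitone (by nlinarith)
    have h1x : (1 : ℝ) ≤ (1 + |x|) ^ k := one_le_pow₀ (by linarith [abs_nonneg x])
    have hsum : |∑ j ∈ Finset.range (k + 1), (-x) ^ j / (j.factorial : ℝ) * iteratedDeriv j Q t|
        ≤ (k + 1) * (C₂ * (Q (θ * t) * (1 + |x|) ^ k)) := by
      refine (Finset.abs_sum_le_sum_abs _ _).trans ?_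
      have : ∀ j ∈ Finset.range (k + 1), |(-x) ^ j / (j.factorial : ℝ) * iteratedDeriv j Q t|
          ≤ C₂ * (Q (θ * t) * (1 + |x|) ^ k) := by
        intro j hj
        have hj : j ≤ k := by simpa [Nat.lt_succ_iff] using hj
        have hfac : (1 : ℝ) ≤ (j.factorial : ℝ) := by
          exact_mod_cast Nat.succ_le_of_lt (Nat.factorial_pos _)
        rw [abs_mul, abs_div, abs_pow, abs_neg, Nat.abs_cast]
        have hd := ht₂ j (by omega)
        have hl1 : logRate t ^ j ≤ 1 := pow_le_one₀ hl0 (logRate_le_one htpos)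
        calc |x| ^ j / (j.factorial : ℝ) * |iteratedDeriv j Q t|
            ≤ |x| ^ j * (C₂ * (logRate t ^ j * Q t)) := by
              gcongr
              exact div_le_self (by positivity) hfac
          _ ≤ (1 + |x|) ^ k * (C₂ * (1 * Q (θ * t))) := by
              gcongr
              calc |x| ^ j ≤ (1 + |x|) ^ j := by gcongr; linarith
                _ ≤ (1 + |x|) ^ k := pow_le_pow_right₀ (by linarith [abs_nonneg x]) hj
          _ = _ := by ring
      refine (Finset.sum_le_sum this).trans ?_
      simp
    have hQmax : |Q (max (t - x) (θ * t))| ≤ Q (θ * t) := by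
      rw [abs_of_nonneg (hQ.nonneg _)]
      exact hQ.antitone (le_max_right _ _)
    calc _ ≤ Q (θ * t) + (k + 1) * (C₂ * (Q (θ * t) * (1 + |x|) ^ k)) :=
          (abs_sub _ _).trans (add_le_add hQmax hsum)
      _ ≤ Q (θ * t) * (1 + |x|) ^ k + (k + 1) * (C₂ * (Q (θ * t) * (1 + |x|) ^ k)) := by
          gcongr
          exact le_mul_of_one_le_right hQθ h1x
      _ = (1 + C₂ * (k + 1)) * Q (θ * t) * (1 + |x|) ^ k * 1 := by ring
      _ ≤ (C₂ * 2 ^ (k + 1) * C₁ + (1 + C₂ * (k + 1))) * Q (θ * t) * (1 + |x|) ^ k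
            * (|x| ^ (2 * N) / t ^ N) := by
          refine mul_le_mul (mul_le_mul_of_nonneg_right (mul_le_mul_of_nonneg_right ?_ hQθ)
            (by positivity)) hratio zero_le_one (by positivity)
          linarith [(by positivity : (0 : ℝ) ≤ C₂ * 2 ^ (k + 1) * C₁)]
      _ = _ := by ring

/-- Convolution with a law having moments of all orders acts on a smooth tail as the Laplace
character, up to one more factor `log t / t`. -/
lemma SmoothTail.integral_sub_laplaceCharacter_isBigO {Q : ℝ → ℝ} {k : ℕ}
    (hQ : SmoothTail Q (k + 1)) {θ : ℝ} (h0 : 0 < θ) (hθ : θ ≤ 1 / 2) (K : Measure ℝ)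
    [IsProbabilityMeasure K] (hK : ∀ n : ℕ, Integrable (fun x : ℝ => x ^ n) K) :
    (fun t => ∫ x, Q (max (t - x) (θ * t)) ∂K - laplaceCharacter K k Q t)
      =O[atTop] fun t => logRate t ^ (k + 1) * Q t := by
  obtain ⟨N, hN⟩ := hQ.exists_comp_mul_le (by omega) h0 (by linarith)
  obtain ⟨C, hC, hb⟩ := hQ.exists_taylor_bound hθ (N + (k + 1))
  have habs : ∀ n : ℕ, Integrable (fun x : ℝ => |x| ^ n) K := fun n => by
    simpa [abs_pow] using (hK n).abs
  have hI2 : Integrable (fun x : ℝ => |x| ^ (2 * (N + (k + 1))) * (1 + |x|) ^ k) K := by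
    have : ∀ x : ℝ, |x| ^ (2 * (N + (k + 1))) * (1 + |x|) ^ k
        = ∑ i ∈ Finset.range (k + 1), |x| ^ (2 * (N + (k + 1)) + i) * (k.choose i : ℝ) := by
      intro x
      rw [add_comm 1 |x|, add_pow, Finset.mul_sum]
      refine Finset.sum_congr rfl fun i _ => ?_
      rw [pow_add]; ring
    simp_rw [this]
    exact integrable_finsetSum _ fun i _ => (habs _).mul_const _
  refine IsBigO.of_bound (C * (∫ x, |x| ^ (k + 1) ∂K)
    + C * (∫ x, |x| ^ (2 * (N + (k + 1))) * (1 + |x|) ^ k ∂K)) ?_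
  filter_upwards [hb, hN, eventually_ge_atTop (exp 1)] with t ht htN hte
  have htpos : 0 < t := (exp_pos 1).trans_le hte
  have hlog1 : 1 ≤ log t := by rwa [le_log_iff_exp_le htpos]
  have hl0 : 0 ≤ logRate t := div_nonneg (by linarith) htpos.le
  have hQt := hQ.nonneg t
  have hmeas : Measurable fun x => Q (max (t - x) (θ * t)) :=
    hQ.antitone.measurable.comp (by fun_prop)
  have hIQ : Integrable (fun x => Q (max (t - x) (θ * t))) K := by
    refine Integrable.of_bound (C := Q (θ * t)) hmeas.aestronglyMeasurable (ae_of_all _ fun x => ?_)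
    rw [norm_of_nonneg (hQ.nonneg _)]
    exact hQ.antitone (le_max_right _ _)
  have hterm : ∀ j : ℕ, (fun x : ℝ => (-x) ^ j / (j.factorial : ℝ) * iteratedDeriv j Q t)
      = fun x => (-1 : ℝ) ^ j / (j.factorial : ℝ) * iteratedDeriv j Q t * x ^ j := by
    intro j; funext x; rw [neg_pow]; ring
  have hIj : ∀ j ∈ Finset.range (k + 1), Integrable
      (fun x : ℝ => (-x) ^ j / (j.factorial : ℝ) * iteratedDeriv j Q t) K := by
    intro j _
    rw [hterm]
    exact (hK j).const_mul _
  have hL : laplaceCharacter K k Q t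
      = ∫ x, ∑ j ∈ Finset.range (k + 1), (-x) ^ j / (j.factorial : ℝ) * iteratedDeriv j Q t ∂K := by
    rw [integral_finsetSum _ hIj, laplaceCharacter]
    rw [show ((k : ℤ) + 1).toNat = k + 1 by omega]
    refine Finset.sum_congr rfl fun j _ => ?_
    rw [hterm, integral_const_mul]
    ring
  rw [hL, ← integral_sub hIQ (integrable_finsetSum _ hIj),
    norm_of_nonneg (by positivity : 0 ≤ logRate t ^ (k + 1) * Q t)]
  refine (norm_integral_le_of_norm_le (((habs (k + 1)).const_mul _).add (hI2.const_mul _))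
    (ae_of_all _ ht)).trans ?_
  simp only [Pi.add_apply]
  rw [integral_add ((habs (k + 1)).const_mul _) (hI2.const_mul _), integral_const_mul,
    integral_const_mul]
  have hpow : Q (θ * t) / t ^ (N + (k + 1)) ≤ logRate t ^ (k + 1) * Q t := by
    rw [pow_add, div_le_iff₀ (by positivity), logRate, div_pow]
    have h3 : (1 : ℝ) ≤ log t ^ (k + 1) := one_le_pow₀ hlog1
    calc Q (θ * t) ≤ t ^ N * Q t * 1 := by linarith
      _ ≤ t ^ N * Q t * log t ^ (k + 1) := by gcongr
      _ = _ := by field_simp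
  have hi1 : 0 ≤ ∫ x, |x| ^ (k + 1) ∂K := integral_nonneg fun x => by positivity
  have hi2 : 0 ≤ ∫ x, |x| ^ (2 * (N + (k + 1))) * (1 + |x|) ^ k ∂K :=
    integral_nonneg fun x => by positivity
  calc _ ≤ C * (logRate t ^ (k + 1) * Q t) * (∫ x, |x| ^ (k + 1) ∂K)
        + C * (logRate t ^ (k + 1) * Q t)
          * ∫ x, |x| ^ (2 * (N + (k + 1))) * (1 + |x|) ^ k ∂K := by gcongr
    _ = _ := by ring

/-! ### Tails of lognormal type -/

section Lognormal

variable {μ : Measure ℝ} [IsProbabilityMeasure μ] {lam : ℝ}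

lemma exists_tail_mul_exp_le (hlam : 0 < lam)
    (hi : hazardRate μ ~[atTop] fun t => lam * t⁻¹ * Real.log t) {κ : ℝ} (hκ : κ < lam) :
    ∃ T ≥ 1, ∀ s t : ℝ, T ≤ s → s ≤ t →
      tail μ t * exp (κ / 2 * (log t ^ 2 - log s ^ 2)) ≤ tail μ s := by
  obtain ⟨t₀, ht₀⟩ := exists_hasDerivAt_tail μ hlam hi
  obtain ⟨u, hu, h⟩ := hi.exists_eq_mul
  obtain ⟨T, hT⟩ := eventually_atTop.1
    ((hu.eventually (lt_mem_nhds ((div_lt_one hlam).2 hκ))).and h)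
  refine ⟨max (max T (t₀ + 1)) 1, le_max_right _ _, fun s t hs hst => ?_⟩
  refine mul_exp_le_of_hasDerivAt (T := max (max T (t₀ + 1)) 1)
    (Q' := fun t => -(hazardRate μ t * tail μ t))
    (lt_of_lt_of_le one_pos (le_max_right _ _)) (fun x hx => ?_) (fun x hx => ?_) hs hst
  · have : t₀ + 1 ≤ x := (le_max_right _ _).trans ((le_max_left _ _).trans hx)
    exact (ht₀ x (by linarith)).2
  · obtain ⟨h1, h2⟩ := hT x ((le_max_left _ _).trans ((le_max_left _ _).trans hx))
    have hx1 : 1 ≤ x := (le_max_right _ _).trans hx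
    rw [div_lt_iff₀ hlam] at h1
    have h3 : κ * logRate x ≤ hazardRate μ x := by
      rw [h2, Pi.mul_apply]
      calc κ * logRate x ≤ u x * lam * logRate x :=
            mul_le_mul_of_nonneg_right h1.le (logRate_nonneg hx1)
        _ = _ := by rw [logRate]; ring
    exact neg_le_neg (mul_le_mul_of_nonneg_right h3 (tail_nonneg μ x))

lemma exists_tail_le_mul_exp (hlam : 0 < lam)
    (hi : hazardRate μ ~[atTop] fun t => lam * t⁻¹ * Real.log t) {κ : ℝ} (hκ : lam < κ) :
    ∃ T ≥ 1, ∀ s t : ℝ, T ≤ s → s ≤ t →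
      tail μ s ≤ tail μ t * exp (κ / 2 * (log t ^ 2 - log s ^ 2)) := by
  obtain ⟨t₀, ht₀⟩ := exists_hasDerivAt_tail μ hlam hi
  obtain ⟨u, hu, h⟩ := hi.exists_eq_mul
  obtain ⟨T, hT⟩ := eventually_atTop.1
    ((hu.eventually (gt_mem_nhds ((one_lt_div hlam).2 hκ))).and h)
  refine ⟨max (max T (t₀ + 1)) 1, le_max_right _ _, fun s t hs hst => ?_⟩
  refine le_mul_exp_of_hasDerivAt (T := max (max T (t₀ + 1)) 1)
    (Q' := fun t => -(hazardRate μ t * tail μ t))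
    (lt_of_lt_of_le one_pos (le_max_right _ _)) (fun x hx => ?_) (fun x hx => ?_) hs hst
  · have : t₀ + 1 ≤ x := (le_max_right _ _).trans ((le_max_left _ _).trans hx)
    exact (ht₀ x (by linarith)).2
  · obtain ⟨h1, h2⟩ := hT x ((le_max_left _ _).trans ((le_max_left _ _).trans hx))
    have hx1 : 1 ≤ x := (le_max_right _ _).trans hx
    rw [lt_div_iff₀ hlam] at h1
    have h3 : hazardRate μ x ≤ κ * logRate x := by
      rw [h2, Pi.mul_apply]
      calc _ = u x * lam * logRate x := by rw [logRate]; ring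
        _ ≤ κ * logRate x := mul_le_mul_of_nonneg_right h1.le (logRate_nonneg hx1)
    exact neg_le_neg (mul_le_mul_of_nonneg_right h3 (tail_nonneg μ x))

lemma tail_pos (hlam : 0 < lam)
    (hi : hazardRate μ ~[atTop] fun t => lam * t⁻¹ * Real.log t) (t : ℝ) : 0 < tail μ t := by
  obtain ⟨t₀, ht₀⟩ := exists_hasDerivAt_tail μ hlam hi
  exact (ht₀ (max (t₀ + 1) t) (by
    have := le_max_left (t₀ + 1) t
    linarith)).1.trans_le (tail_antitone μ (le_max_right _ _))

lemma exists_tail_mul_le (hlam : 0 < lam)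
    (hi : hazardRate μ ~[atTop] fun t => lam * t⁻¹ * Real.log t) {κ : ℝ} (hκ0 : 0 ≤ κ)
    (hκ : κ < lam) :
    ∃ T ≥ 1, ∀ t ≥ T, ∀ u ≥ 1, tail μ (u * t) ≤ tail μ t * exp (-(κ * log u * log t)) := by
  obtain ⟨T, hT1, hT⟩ := exists_tail_mul_exp_le hlam hi hκ
  refine ⟨T, hT1, fun t ht u hu => ?_⟩
  have ht0 : 0 < t := by linarith
  have hu0 : 0 < u := by linarith
  have h := hT t (u * t) ht (by nlinarith)
  rw [exp_neg, ← div_eq_mul_inv, le_div_iff₀ (exp_pos _)]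
  refine le_trans (mul_le_mul_of_nonneg_left (exp_le_exp.2 ?_) (tail_nonneg μ _)) h
  rw [log_mul hu0.ne' ht0.ne']
  nlinarith [mul_nonneg hκ0 (sq_nonneg (log u))]

lemma tail_isBigO_exp (hlam : 0 < lam)
    (hi : hazardRate μ ~[atTop] fun t => lam * t⁻¹ * Real.log t) {κ : ℝ} (hκ : κ < lam) :
    tail μ =O[atTop] fun t => exp (-(κ / 2 * log t ^ 2)) := by
  obtain ⟨T, hT1, hT⟩ := exists_tail_mul_exp_le hlam hi hκ
  refine IsBigO.of_bound (tail μ T * exp (κ / 2 * log T ^ 2)) ?_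
  filter_upwards [eventually_ge_atTop T] with t ht
  have h := hT T t le_rfl ht
  rw [norm_of_nonneg (tail_nonneg μ t), norm_of_nonneg (exp_pos _).le, exp_neg,
    ← div_eq_mul_inv, le_div_iff₀ (exp_pos _)]
  rwa [mul_sub, exp_sub, mul_div_assoc', div_le_iff₀ (exp_pos _)] at h

lemma exp_isBigO_tail (hlam : 0 < lam)
    (hi : hazardRate μ ~[atTop] fun t => lam * t⁻¹ * Real.log t) {κ : ℝ} (hκ : lam < κ) :
    (fun t => exp (-(κ / 2 * log t ^ 2))) =O[atTop] tail μ := by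
  obtain ⟨T, hT1, hT⟩ := exists_tail_le_mul_exp hlam hi hκ
  have hpos := tail_pos hlam hi T
  refine IsBigO.of_bound (tail μ T * exp (κ / 2 * log T ^ 2))⁻¹ ?_
  filter_upwards [eventually_ge_atTop T] with t ht
  have h := hT T t le_rfl ht
  rw [norm_of_nonneg (tail_nonneg μ t), norm_of_nonneg (exp_pos _).le, exp_neg,
    inv_mul_eq_div, le_div_iff₀ (by positivity), inv_mul_eq_div, div_le_iff₀ (exp_pos _)]
  rwa [mul_sub, exp_sub, mul_div_assoc', le_div_iff₀ (exp_pos _)] at h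

/-- On `n ≤ |x| < n + 1` the function is at most `g (n + 1)`; the shift to `n - 1 < |x|` only turns
the inequality into a strict one, as in the definition of the tail. -/
lemma integrable_comp_abs_of_summable {g : ℝ → ℝ} (hg : MonotoneOn g (Ici 0))
    (h0 : ∀ t, 0 ≤ g t) (hm : Measurable g)
    (hs : Summable fun n : ℕ => g (n + 1) * μ.real {x | (n : ℝ) - 1 < |x|}) :
    Integrable (fun x => g |x|) μ := by
  refine ⟨(hm.comp measurable_norm).aestronglyMeasurable, ?_⟩
  have hset : ∀ n : ℕ, MeasurableSet {x : ℝ | (n : ℝ) - 1 < |x|} := fun n =>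
    measurableSet_lt measurable_const measurable_norm
  have hle : ∀ x : ℝ, ‖g |x|‖ₑ
      ≤ ∑' n : ℕ, {x : ℝ | (n : ℝ) - 1 < |x|}.indicator
          (fun _ => ENNReal.ofReal (g (n + 1))) x := by
    intro x
    refine le_trans ?_ (ENNReal.le_tsum ⌊|x|⌋₊)
    have h1 : (⌊|x|⌋₊ : ℝ) ≤ |x| := Nat.floor_le (abs_nonneg x)
    rw [indicator_of_mem (by rw [mem_ofPred_eq]; linarith), Real.enorm_of_nonneg (h0 _)]
    exact ENNReal.ofReal_le_ofReal (hg (abs_nonneg x)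
      (by simp only [mem_Ici]; positivity) (Nat.lt_floor_add_one _).le)
  calc ∫⁻ x, ‖g |x|‖ₑ ∂μ ≤ ∫⁻ x, ∑' n : ℕ, {x : ℝ | (n : ℝ) - 1 < |x|}.indicator
          (fun _ => ENNReal.ofReal (g (n + 1))) x ∂μ := lintegral_mono hle
    _ = ∑' n : ℕ, ENNReal.ofReal (g (n + 1) * μ.real {x | (n : ℝ) - 1 < |x|}) := by
        rw [lintegral_tsum fun n => (measurable_const.indicator (hset n)).aemeasurable]
        refine tsum_congr fun n => ?_
        rw [lintegral_indicator_const (hset n), ENNReal.ofReal_mul (h0 _), ofReal_measureReal]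
    _ < ⊤ := hs.tsum_ofReal_lt_top

/-- Moments of `|X|` weighted by a quadratic exponential in `log |X|`. They are finite since the
coefficient `lam / 4` is below the value `lam / 2` that governs the decay of the tail. -/
lemma integrable_pow_mul_exp_log_sq (hlam : 0 < lam)
    (hi : hazardRate μ ~[atTop] fun t => lam * t⁻¹ * Real.log t)
    (habs : (fun t => μ.real {x | t < |x|}) =O[atTop] tail μ) (n : ℕ) {a : ℝ} (ha : 1 ≤ a) :
    Integrable (fun x => |x| ^ n * exp (lam / 4 * log (max (a * |x|) 1) ^ 2)) μ := by
  set g : ℝ → ℝ := fun t => |t| ^ n * exp (lam / 4 * log (max (a * |t|) 1) ^ 2) with hg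
  have hlogm : ∀ t : ℝ, 0 ≤ log (max (a * |t|) 1) := fun t => log_nonneg (le_max_right _ _)
  have key : Integrable (fun x => g |x|) μ := by
    refine integrable_comp_abs_of_summable ?_ (fun t => by positivity) (by fun_prop) ?_
    · intro s hs t ht hst
      simp only [mem_Ici] at hs ht
      have := hlogm s
      simp only [hg, abs_of_nonneg hs, abs_of_nonneg ht] at this ⊢
      gcongr
    rw [← summable_nat_add_iff 1]
    refine summable_of_isBigO_nat (g := fun n : ℕ => ((n : ℝ) ^ 2)⁻¹)
      (Real.summable_nat_pow_inv.2 one_lt_two) ?_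
    have h1 := habs.trans (tail_isBigO_exp hlam hi (κ := 3 / 4 * lam) (by linarith))
    have h2 : (fun t : ℝ => g (t + 2) * μ.real {x | t < |x|}) =O[atTop] fun t => (t ^ 2)⁻¹ := by
      have h3 : (fun t : ℝ => g (t + 2) * exp (-(3 / 4 * lam / 2 * log t ^ 2)))
          =O[atTop] fun t => (t ^ 2)⁻¹ := by
        refine IsBigO.of_bound 1 ?_
        set b := log (3 * a) with hb
        have hb0 : 0 ≤ b := log_nonneg (by linarith)
        set D := n + lam * b / 2 + 2 + (n * b + lam * b ^ 2 / 4) with hD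
        have hD0 : 0 ≤ D := by positivity
        filter_upwards [tendsto_log_atTop.eventually_ge_atTop (max 1 (8 / lam * D)),
          eventually_ge_atTop 1] with t hL ht
        have ht0 : 0 < t := by linarith
        have hL1 : 1 ≤ log t := (le_max_left _ _).trans hL
        have hL2 : 8 / lam * D ≤ log t := (le_max_right _ _).trans hL
        have ht2 : t + 2 ≤ 3 * a * t := by nlinarith
        have hlog : log (3 * a * t) = b + log t := log_mul (by positivity) ht0.ne'
        have hg2 : g (t + 2) ≤ exp (n * (b + log t) + lam / 4 * (b + log t) ^ 2) := by
          rw [exp_add]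
          simp only [hg]
          rw [abs_of_nonneg (by linarith : 0 ≤ t + 2)]
          have h5 : log (max (a * (t + 2)) 1) ≤ b + log t := by
            rw [← hlog]
            refine log_le_log (by positivity) (max_le ?_ ?_)
            · nlinarith
            · nlinarith
          have h6 : 0 ≤ log (max (a * (t + 2)) 1) := log_nonneg (le_max_right _ _)
          have h7 : (t + 2) ^ n ≤ exp (n * (b + log t)) := by
            rw [← hlog, mul_comm, exp_mul, exp_log (by positivity), rpow_natCast]
            gcongr
          gcongr
        rw [norm_of_nonneg (by positivity), norm_of_nonneg (by positivity), one_mul]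
        calc g (t + 2) * exp (-(3 / 4 * lam / 2 * log t ^ 2))
            ≤ exp (n * (b + log t) + lam / 4 * (b + log t) ^ 2)
              * exp (-(3 / 4 * lam / 2 * log t ^ 2)) := by gcongr
          _ ≤ exp (-(2 * log t)) := by
              rw [← exp_add, exp_le_exp]
              have h8 : D ≤ lam / 8 * log t := by
                rw [div_mul_eq_mul_div, div_le_iff₀ hlam] at hL2
                linarith
              have h9 : D * log t ≤ lam / 8 * log t * log t := by gcongr
              have h10 : n * b + lam * b ^ 2 / 4 ≤ (n * b + lam * b ^ 2 / 4) * log t :=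
                le_mul_of_one_le_right (by positivity) hL1
              have h11 : D * log t = (n + lam * b / 2 + 2) * log t
                + (n * b + lam * b ^ 2 / 4) * log t := by rw [hD]; ring
              nlinarith
          _ = (t ^ 2)⁻¹ := by
              rw [exp_neg, mul_comm, exp_mul, exp_log ht0]
              norm_num
      exact ((isBigO_refl (fun t : ℝ => g (t + 2)) atTop).mul h1).trans h3
    refine (h2.comp_tendsto tendsto_natCast_atTop_atTop).congr_left fun k => ?_
    simp only [Function.comp_apply, Nat.cast_add, Nat.cast_one]
    rw [show (k : ℝ) + 1 - 1 = k by ring, show (k : ℝ) + 1 + 1 = k + 2 by ring]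
  simpa [hg, abs_abs] using key

lemma integrable_abs_pow (hlam : 0 < lam)
    (hi : hazardRate μ ~[atTop] fun t => lam * t⁻¹ * Real.log t)
    (habs : (fun t => μ.real {x | t < |x|}) =O[atTop] tail μ) (n : ℕ) :
    Integrable (fun x => |x| ^ n) μ := by
  refine (integrable_pow_mul_exp_log_sq hlam hi habs n le_rfl).mono' (by fun_prop)
    (ae_of_all _ fun x => ?_)
  rw [norm_of_nonneg (by positivity)]
  exact le_mul_of_one_le_right (by positivity) (one_le_exp (by positivity))

end Lognormal

/-! ### Weighted sums of independent variables -/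

section Sum

variable {Ω : Type*} [MeasurableSpace Ω] {P : Measure Ω} {μ : Measure ℝ}
  {X : ℤ → Ω → ℝ}

lemma memLp_id_of_integrable_pow {K : Measure ℝ} {n : ℕ} (hn : n ≠ 0)
    (h : Integrable (fun x : ℝ => |x| ^ n) K) : MemLp (fun x : ℝ => x) n K := by
  rw [← integrable_norm_rpow_iff (by fun_prop) (by exact_mod_cast hn) (by simp)]
  simpa using h

lemma tsum_eLpNorm_ne_top (hlaw : ∀ i, HasLaw (X i) μ P) {c : ℤ → ℝ}
    (hc : Summable fun i => |c i|) {n : ℕ} (hn : n ≠ 0)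
    (hm : Integrable (fun x : ℝ => |x| ^ n) μ) :
    (∀ i, MemLp (fun ω => c i * X i ω) n P) ∧ ∑' i, eLpNorm (fun ω => c i * X i ω) n P ≠ ⊤ := by
  have hid := memLp_id_of_integrable_pow hn hm
  have hX : ∀ i, MemLp (X i) n P ∧ eLpNorm (X i) n P = eLpNorm (fun x : ℝ => x) n μ := by
    intro i
    have hae := (hlaw i).aemeasurable
    have hsm : AEStronglyMeasurable (fun x : ℝ => x) (P.map (X i)) :=
      measurable_id.aestronglyMeasurable
    have h1 := memLp_map_measure_iff (p := (n : ENNReal)) hsm hae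
    have h2 := eLpNorm_map_measure (p := (n : ENNReal)) hsm hae
    rw [(hlaw i).map_eq] at h1 h2
    exact ⟨h1.1 hid, h2.symm⟩
  refine ⟨fun i => (hX i).1.const_mul _, ?_⟩
  have : ∀ i, eLpNorm (fun ω => c i * X i ω) n P
      = ENNReal.ofReal |c i| * eLpNorm (fun x : ℝ => x) n μ := by
    intro i
    have := eLpNorm_const_smul (c i) (X i) n P
    rw [(hX i).2] at this
    rw [← Real.enorm_eq_ofReal_abs, ← this]
    rfl
  simp_rw [this]
  rw [ENNReal.tsum_mul_right]
  exact ENNReal.mul_ne_top hc.tsum_ofReal_lt_top.ne hid.eLpNorm_ne_top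

lemma ae_summable (hlaw : ∀ i, HasLaw (X i) μ P) {c : ℤ → ℝ}
    (hc : Summable fun i => |c i|) (hm : Integrable (fun x : ℝ => |x| ^ 1) μ) :
    ∀ᵐ ω ∂P, Summable fun i => c i * X i ω := by
  obtain ⟨h1, h2⟩ := tsum_eLpNorm_ne_top hlaw hc one_ne_zero hm
  have := summable_norm_of_tsum_eLpNorm_ne_top (by simp) (fun i => (h1 i).aestronglyMeasurable) h2
  filter_upwards [this] with ω h
  exact h.of_norm

/-- The series converges in `L^n`, since the norms of its terms are summable. -/
lemma memLp_tsum (hlaw : ∀ i, HasLaw (X i) μ P) {c : ℤ → ℝ}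
    (hc : Summable fun i => |c i|) {n : ℕ} (hn : n ≠ 0)
    (hm : Integrable (fun x : ℝ => |x| ^ n) μ) :
    MemLp (fun ω => ∑' i, c i * X i ω) n P := by
  obtain ⟨h1, h2⟩ := tsum_eLpNorm_ne_top hlaw hc hn hm
  have : Fact ((1 : ENNReal) ≤ n) := ⟨by exact_mod_cast Nat.one_le_iff_ne_zero.2 hn⟩
  have h3 := Lp.hasSum_coeFn_tsum (μ := P) (f := fun i => (h1 i).toLp) (by
    simpa only [Lp.enorm_toLp] using h2)
  have h4 : ∀ᵐ ω ∂P, ∀ i, (h1 i).toLp (fun ω => c i * X i ω) ω = c i * X i ω :=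
    ae_all_iff.2 fun i => (h1 i).coeFn_toLp
  refine (memLp_congr_ae ?_).1 (Lp.memLp (∑' i, (h1 i).toLp))
  filter_upwards [h3, h4] with ω h5 h6
  rw [← h5.tsum_eq]
  exact tsum_congr h6

lemma integrable_pow_sumLaw [IsProbabilityMeasure P] (hlaw : ∀ i, HasLaw (X i) μ P) {c : ℤ → ℝ}
    (hc : Summable fun i => |c i|) (hm : ∀ n : ℕ, Integrable (fun x : ℝ => |x| ^ n) μ) (n : ℕ) :
    Integrable (fun x : ℝ => x ^ n) (sumLaw P X c) := by
  have hae : AEMeasurable (fun ω => ∑' i, c i * X i ω) P :=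
    (memLp_tsum hlaw hc one_ne_zero (hm 1)).aemeasurable
  rw [sumLaw, integrable_map_measure (by fun_prop) hae]
  rcases eq_or_ne n 0 with rfl | hn
  · simp [Function.comp_def]
  have h := (memLp_tsum hlaw hc hn (hm n)).integrable_norm_pow hn
  refine (integrable_norm_iff (by
    exact ((measurable_id.pow_const n).comp_aemeasurable hae).aestronglyMeasurable)).1 ?_
  simpa [Function.comp_def] using h

lemma isProbabilityMeasure_sumLaw [IsProbabilityMeasure P] (hlaw : ∀ i, HasLaw (X i) μ P) {c : ℤ → ℝ}
    (hc : Summable fun i => |c i|) (hm : Integrable (fun x : ℝ => |x| ^ 1) μ) :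
    IsProbabilityMeasure (sumLaw P X c) :=
  Measure.isProbabilityMeasure_map (memLp_tsum hlaw hc one_ne_zero hm).aemeasurable

lemma summable_abs_update {c : ℤ → ℝ} (hc : Summable fun i => |c i|) (i : ℤ) :
    Summable fun j => |Function.update c i 0 j| := by
  refine Summable.of_nonneg_of_le (fun j => abs_nonneg _) (fun j => ?_) hc
  rcases eq_or_ne j i with rfl | h
  · simp
  · rw [Function.update_of_ne h]

lemma tsum_eq_add_deleted {c x : ℤ → ℝ} (hs : Summable fun j => c j * x j) (i : ℤ) :
    ∑' j, c j * x j = c i * x i + ∑' j, Function.update c i 0 j * x j := by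
  have h := hs.hasSum.update i 0
  have h2 : (Function.update (fun j => c j * x j) i 0) = fun j => Function.update c i 0 j * x j := by
    funext j
    rcases eq_or_ne j i with rfl | h
    · simp
    · rw [Function.update_of_ne h, Function.update_of_ne h]
  rw [h2] at h
  rw [h.tsum_eq]
  ring

lemma indepFun_deleted (hindep : iIndepFun X P) (hX : ∀ i, AEMeasurable (X i) P) (c : ℤ → ℝ)
    (i : ℤ) :
    IndepFun (X i) (fun ω => ∑' j, Function.update c i 0 j * X j ω) P := by
  set X' : ℤ → Ω → ℝ := fun j => (hX j).mk (X j) with hX'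
  have hXm : ∀ j, Measurable (X' j) := fun j => (hX j).measurable_mk
  have hae : ∀ j, X j =ᵐ[P] X' j := fun j => (hX j).ae_eq_mk
  have hind : iIndepFun X' P := hindep.congr hae
  set d := Function.update c i 0 with hd
  set V : Ω → ℝ := fun ω => ∑' j, d j * X' j ω with hV
  have hVae : (fun ω => ∑' j, d j * X j ω) =ᵐ[P] V := by
    filter_upwards [ae_all_iff.2 hae] with ω h2
    simp only [hV, h2]
  set 𝒢 : MeasurableSpace Ω := ⨆ j ∈ ({i}ᶜ : Set ℤ),
    MeasurableSpace.comap (X' j) inferInstance with h𝒢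
  have hterm : ∀ j, Measurable[𝒢] fun ω => d j * X' j ω := by
    intro j
    rcases eq_or_ne j i with rfl | h
    · have : (fun ω => d j * X' j ω) = fun _ => (0 : ℝ) := by
        funext ω; simp [hd]
      rw [this]
      exact measurable_const
    · have hle : MeasurableSpace.comap (X' j) inferInstance ≤ 𝒢 :=
        le_iSup₂ (f := fun j (_ : j ∈ ({i}ᶜ : Set ℤ)) =>
          MeasurableSpace.comap (X' j) (inferInstance : MeasurableSpace ℝ)) j h
      have : Measurable[𝒢] (X' j) := (comap_measurable (X' j)).mono hle le_rfl
      exact this.const_mul _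
  have hVm : Measurable[𝒢] V := Measurable.tsum hterm
  have hInd : Indep (⨆ j ∈ ({i} : Set ℤ), MeasurableSpace.comap (X' j) inferInstance) 𝒢 P :=
    indep_iSup_of_disjoint (fun j => (hXm j).comap_le) hind.iIndep
      (disjoint_compl_right (a := ({i} : Set ℤ)))
  have hfin : IndepFun (X' i) V P := by
    refine indep_of_indep_of_le_left (indep_of_indep_of_le_right hInd hVm.comap_le) ?_
    exact le_iSup₂ (f := fun j (_ : j ∈ ({i} : Set ℤ)) =>
          MeasurableSpace.comap (X' j) (inferInstance : MeasurableSpace ℝ)) i rfl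
  exact hfin.congr (hae i).symm hVae.symm

lemma tail_mulLaw (hlaw : ∀ i, HasLaw (X i) μ P) (i : ℤ) (c t : ℝ) :
    P.real {ω | t < c * X i ω} = tail (mulLaw c μ) t := by
  rw [tail, mulLaw, map_measureReal_apply (by fun_prop) measurableSet_Ioi,
    (hlaw i).measureReal_eq (p := fun x => t < c * x) (measurableSet_lt (by fun_prop) (by fun_prop))]
  rfl

/-- Conditioning on the sum of the other terms. -/
lemma measureReal_sum_gt_and_large [IsProbabilityMeasure P] [IsProbabilityMeasure μ]
    (hindep : iIndepFun X P) (hlaw : ∀ i, HasLaw (X i) μ P)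
    {c : ℤ → ℝ} (hc : Summable fun i => |c i|) (hm : Integrable (fun x : ℝ => |x| ^ 1) μ)
    (i : ℤ) (t s : ℝ) :
    P.real {ω | t < ∑' j, c j * X j ω ∧ s < c i * X i ω}
      = ∫ x, tail (mulLaw (c i) μ) (max (t - x) s) ∂(deletedLaw P X c i) := by
  have hd := summable_abs_update hc i
  have hmeas := (memLp_tsum hlaw hd one_ne_zero hm).aemeasurable
  have hXi := (hlaw i).aemeasurable
  have hind := (indepFun_deleted hindep (fun j => (hlaw j).aemeasurable) c i).comp
    (φ := fun x => c i * x) (ψ := id) (by fun_prop) measurable_id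
  have hmap := (indepFun_iff_map_prod_eq_prod_map_map (hXi.const_mul _) hmeas).1 hind
  have hprob := isProbabilityMeasure_sumLaw hlaw hd hm
  have hmu : P.map (fun ω => c i * X i ω) = mulLaw (c i) μ := by
    rw [mulLaw, ← (hlaw i).map_eq, AEMeasurable.map_map_of_aemeasurable (by fun_prop) hXi]
    rfl
  have hprob' : IsProbabilityMeasure (mulLaw (c i) μ) :=
    Measure.isProbabilityMeasure_map (by fun_prop)
  set A : Set (ℝ × ℝ) := {p | t < p.1 + p.2 ∧ s < p.1} with hA
  have hAm : MeasurableSet A := by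
    have h1 : MeasurableSet {p : ℝ × ℝ | t < p.1 + p.2} :=
      measurableSet_lt measurable_const (by fun_prop)
    have h2 : MeasurableSet {p : ℝ × ℝ | s < p.1} :=
      measurableSet_lt measurable_const (by fun_prop)
    exact h1.inter h2
  have h1 : P {ω | t < ∑' j, c j * X j ω ∧ s < c i * X i ω}
      = ((mulLaw (c i) μ).prod (deletedLaw P X c i)) A := by
    have h2 : P.map (fun ω => (c i * X i ω, ∑' j, Function.update c i 0 j * X j ω))
        = (mulLaw (c i) μ).prod (deletedLaw P X c i) := by
      rw [← hmu]; exact hmap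
    rw [← h2, Measure.map_apply_of_aemeasurable ((hXi.const_mul _).prodMk hmeas) hAm]
    refine measure_congr ?_
    filter_upwards [ae_summable hlaw hc hm] with ω hω
    simp only [eq_iff_iff, hA]
    change (_ ∧ _) ↔ (_ ∧ _)
    rw [tsum_eq_add_deleted hω i]
  have h3 : ∀ x, (fun y => (y, x)) ⁻¹' A = Ioi (max (t - x) s) := by
    intro x; ext y
    simp only [hA, mem_preimage, mem_ofPred_eq, mem_Ioi, max_lt_iff, sub_lt_iff_lt_add]
  have hprob2 : IsProbabilityMeasure (deletedLaw P X c i) := hprob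
  rw [measureReal_def, h1, Measure.prod_apply_symm hAm]
  simp_rw [h3]
  rw [integral_eq_lintegral_of_nonneg_ae (ae_of_all _ fun x => tail_nonneg _ _)
    ((tail_antitone (mulLaw (c i) μ)).measurable.comp (by fun_prop)).aestronglyMeasurable]
  congr 1
  refine lintegral_congr fun x => ?_
  rw [tail, ofReal_measureReal]

lemma measureReal_large_and_large (hindep : iIndepFun X P) (hlaw : ∀ i, HasLaw (X i) μ P)
    {i j : ℤ} (hij : i ≠ j) (a b s t : ℝ) :
    P.real ({ω | s < a * X i ω} ∩ {ω | t < b * X j ω})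
      = tail (mulLaw a μ) s * tail (mulLaw b μ) t := by
  rw [← tail_mulLaw hlaw i a s, ← tail_mulLaw hlaw j b t]
  have h := (hindep.indepFun hij).measure_inter_preimage_eq_mul {x | s < a * x} {x | t < b * x}
    (measurableSet_lt (by fun_prop) (by fun_prop)) (measurableSet_lt (by fun_prop) (by fun_prop))
  rw [measureReal_def, measureReal_def, measureReal_def, ← ENNReal.toReal_mul]
  exact congrArg ENNReal.toReal h

end Sum

/-! ### Inclusion-exclusion -/

/-- The probability of `B` is that of `B` outside all `A i` plus the sum of those of the `B ∩ A i`, up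
to the probabilities of the intersections of two of the `A i`. -/
lemma abs_measureReal_sub_sum_le {Ω : Type*} [MeasurableSpace Ω] (P : Measure Ω)
    [IsFiniteMeasure P] (B : Set Ω) (A : ℤ → Set Ω) (hA : ∀ i, NullMeasurableSet (A i) P)
    (I : Finset ℤ) :
    |P.real B - P.real (B ∩ ⋂ i ∈ I, (A i)ᶜ) - ∑ i ∈ I, P.real (B ∩ A i)|
      ≤ ∑ i ∈ I, ∑ j ∈ I.erase i, P.real (A i ∩ A j) := by
  classical
  induction I using Finset.induction_on with
  | empty => simp
  | insert a s ha ih =>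
    set D := B ∩ ⋂ i ∈ s, (A i)ᶜ with hD
    have h1 : B ∩ ⋂ i ∈ insert a s, (A i)ᶜ = D \ A a := by
      rw [Finset.set_biInter_insert, hD]
      ext ω
      simp only [mem_inter_iff, Set.mem_sdiff, mem_compl_iff]
      tauto
    have h2 : P.real (D ∩ A a) + P.real (D \ A a) = P.real D :=
      measureReal_inter_add_sdiff₀ (hA a)
    have hle : P.real (D ∩ A a) ≤ P.real (B ∩ A a) :=
      measureReal_mono (inter_subset_inter_left _ inter_subset_left)
    have hsub : B ∩ A a ⊆ (D ∩ A a) ∪ ⋃ j ∈ s, (A a ∩ A j) := by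
      intro ω hω
      by_cases h : ∃ j ∈ s, ω ∈ A j
      · obtain ⟨j, hj, hωj⟩ := h
        exact Or.inr (mem_iUnion₂.2 ⟨j, hj, hω.2, hωj⟩)
      · push Not at h
        exact Or.inl ⟨⟨hω.1, mem_iInter₂.2 h⟩, hω.2⟩
    have hge : P.real (B ∩ A a) ≤ P.real (D ∩ A a) + ∑ j ∈ s, P.real (A a ∩ A j) :=
      (measureReal_mono hsub).trans ((measureReal_union_le _ _).trans
        (add_le_add le_rfl (measureReal_biUnion_finset_le _ _)))
    have hmono : ∑ i ∈ s, ∑ j ∈ s.erase i, P.real (A i ∩ A j)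
        ≤ ∑ i ∈ s, ∑ j ∈ (insert a s).erase i, P.real (A i ∩ A j) :=
      Finset.sum_le_sum fun i _ => Finset.sum_le_sum_of_subset_of_nonneg
        (Finset.erase_subset_erase _ (Finset.subset_insert _ _)) fun _ _ _ => measureReal_nonneg
    rw [h1, Finset.sum_insert ha, Finset.sum_insert ha, Finset.erase_insert ha]
    rw [abs_le] at ih ⊢
    constructor <;> linarith [ih.1, ih.2]

/-! ### Sums without large terms -/

lemma tendsto_log_sq_div_sqrt : Tendsto (fun t : ℝ => log t ^ 2 / √t) atTop (𝓝 0) := by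
  have h : Tendsto (fun t : ℝ => 4 * (log t ^ 2 / t)) atTop (𝓝 (4 * 0)) :=
    ((isLittleO_pow_log_id_atTop (n := 2)).tendsto_div_nhds_zero).const_mul 4
  rw [mul_zero] at h
  refine (h.comp tendsto_sqrt_atTop).congr' ?_
  filter_upwards [eventually_ge_atTop 0] with t ht
  simp only [Function.comp_apply]
  rw [log_sqrt ht]
  ring

/-- With the exponent `s = lam * log t ^ 2 / t`, the exponential of a variable truncated at
`t / 16` is bounded uniformly in `t` by an integrable function. -/
lemma exp_mul_min_le {lam : ℝ} (hlam : 0 < lam) (a : ℝ) :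
    ∀ᶠ t in atTop, ∀ x : ℝ, exp (lam * log t ^ 2 / t * min (a * |x|) (t / 16))
      ≤ 2 + exp (lam / 4 * log (max (a * |x|) 1) ^ 2) := by
  have h1 : ∀ᶠ t : ℝ in atTop, lam * (log t ^ 2 / √t) < log 2 := by
    have := tendsto_log_sq_div_sqrt.const_mul lam
    rw [mul_zero] at this
    exact this.eventually (gt_mem_nhds (log_pos one_lt_two))
  filter_upwards [h1, eventually_ge_atTop 1] with t ht ht1 x
  have ht0 : 0 < t := by linarith
  have hs0 : 0 < √t := sqrt_pos.2 ht0
  have hsq : √t * √t = t := mul_self_sqrt ht0.le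
  have hs : 0 ≤ lam * log t ^ 2 / t := by positivity
  -- if `√t < a * |x|`, then `log t / 2 ≤ log (a * |x|)`: hence the truncation at `t / 16`
  rcases le_or_gt (a * |x|) √t with h | h
  · have h2 : lam * log t ^ 2 / t * min (a * |x|) (t / 16) ≤ log 2 := by
      refine le_trans ?_ ht.le
      calc _ ≤ lam * log t ^ 2 / t * √t :=
            mul_le_mul_of_nonneg_left ((min_le_left _ _).trans h) hs
        _ = lam * (log t ^ 2 / √t) := by
            nth_rewrite 2 [← hsq]
            field_simp
    have h3 := exp_le_exp.2 h2
    rw [exp_log two_pos] at h3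
    linarith [exp_pos (lam / 4 * log (max (a * |x|) 1) ^ 2)]
  · have h2 : lam * log t ^ 2 / t * min (a * |x|) (t / 16)
        ≤ lam / 4 * log (max (a * |x|) 1) ^ 2 := by
      calc _ ≤ lam * log t ^ 2 / t * (t / 16) :=
            mul_le_mul_of_nonneg_left (min_le_right _ _) hs
        _ = lam / 4 * (log t / 2) ^ 2 := by field_simp; ring
        _ ≤ _ := by
            have h3 : log t / 2 ≤ log (max (a * |x|) 1) := by
              rw [← log_sqrt ht0.le]
              exact log_le_log hs0 (h.le.trans (le_max_left _ _))
            have h4 : 0 ≤ log t / 2 := by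
              have := log_nonneg ht1
              linarith
            gcongr
    linarith [exp_le_exp.2 h2]

section Sum

variable {Ω : Type*} [MeasurableSpace Ω] {P : Measure Ω} {μ : Measure ℝ} {X : ℤ → Ω → ℝ}

lemma mgf_truncated_le [IsProbabilityMeasure P] {i : ℤ} (hlaw : HasLaw (X i) μ P)
    {c a s τ : ℝ} (hca : |c| ≤ a) (hs : 0 ≤ s) (hτ : 0 ≤ τ) {g : ℝ → ℝ}
    (hg : ∀ x, exp (s * min (a * |x|) τ) ≤ g x) (hint : Integrable (fun x => |x| * g x) μ) :
    mgf (fun ω => min (max (c * X i ω) 0) τ) P s ≤ exp (s * |c| * ∫ x, |x| * g x ∂μ) := by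
  set f : ℝ → ℝ := fun x => min (max (c * x) 0) τ with hf
  have hf0 : ∀ x, 0 ≤ f x := fun x => le_min (le_max_right _ _) hτ
  have hpt : ∀ x, exp (s * f x) ≤ 1 + s * |c| * (|x| * g x) := by
    intro x
    have h1 : exp (s * f x) ≤ 1 + s * f x * exp (s * f x) := by
      have h2 := add_one_le_exp (-(s * f x))
      have h3 := mul_le_mul_of_nonneg_right h2 (exp_pos (s * f x)).le
      rw [← exp_add, neg_add_cancel, exp_zero] at h3
      linarith
    have h4 : f x ≤ |c| * |x| := (min_le_left _ _).trans
      (max_le ((le_abs_self _).trans (abs_mul c x).le) (by positivity))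
    have h5 : f x ≤ min (a * |x|) τ := le_min (h4.trans (by gcongr)) (min_le_right _ _)
    have h6 : exp (s * f x) ≤ g x := (exp_le_exp.2 (by gcongr)).trans (hg x)
    calc exp (s * f x) ≤ 1 + s * f x * exp (s * f x) := h1
      _ ≤ 1 + s * (|c| * |x|) * g x := by
          have := hf0 x
          gcongr
      _ = _ := by ring
  have hprob : IsProbabilityMeasure μ := by
    rw [← hlaw.map_eq]
    exact Measure.isProbabilityMeasure_map hlaw.aemeasurable
  have hfm : Measurable f := by fun_prop
  have hI : Integrable (fun x => exp (s * f x)) μ := by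
    refine Integrable.of_bound (C := exp (s * τ)) (by fun_prop) (ae_of_all _ fun x => ?_)
    rw [norm_of_nonneg (exp_pos _).le]
    exact exp_le_exp.2 (mul_le_mul_of_nonneg_left (min_le_right _ _) hs)
  have h1 : mgf (fun ω => f (X i ω)) P s = ∫ x, exp (s * f x) ∂μ :=
    hlaw.integral_comp (f := fun x => exp (s * f x)) hI.aestronglyMeasurable
  change mgf (fun ω => f (X i ω)) P s ≤ _
  rw [h1]
  calc ∫ x, exp (s * f x) ∂μ ≤ ∫ x, (1 + s * |c| * (|x| * g x)) ∂μ :=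
        integral_mono hI ((integrable_const _).add (hint.const_mul _)) hpt
    _ = 1 + s * |c| * ∫ x, |x| * g x ∂μ := by
        rw [integral_add (integrable_const _) (hint.const_mul _), integral_const_mul]
        simp
    _ ≤ _ := by
        rw [add_comm]
        exact add_one_le_exp _

/-- Chernoff bound for the sums of the variables truncated at `t / 16`. -/
lemma measureReal_exists_sum_truncated_gt_le [IsProbabilityMeasure P] (hindep : iIndepFun X P)
    (hlaw : ∀ i, HasLaw (X i) μ P) {c : ℤ → ℝ} (hc : Summable fun i => |c i|) {lam a : ℝ}
    (hlam : 0 < lam) (ha : ∀ i, |c i| ≤ a)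
    (hint : Integrable (fun x => |x| * (2 + exp (lam / 4 * log (max (a * |x|) 1) ^ 2))) μ) :
    ∀ᶠ t in atTop,
      P.real {ω | ∃ F : Finset ℤ, t < ∑ i ∈ F, min (max (c i * X i ω) 0) (t / 16)}
        ≤ exp 1 * exp (-(lam * log t ^ 2)) := by
  set K := ∫ x, |x| * (2 + exp (lam / 4 * log (max (a * |x|) 1) ^ 2)) ∂μ with hK
  have hK0 : 0 ≤ K := integral_nonneg fun x => by positivity
  have hsmall : ∀ᶠ t : ℝ in atTop, lam * log t ^ 2 / t * ((∑' i, |c i|) * K) < 1 := by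
    have h := ((isLittleO_pow_log_id_atTop (n := 2)).tendsto_div_nhds_zero).const_mul
      (lam * ((∑' i, |c i|) * K))
    rw [mul_zero] at h
    filter_upwards [h.eventually (gt_mem_nhds zero_lt_one)] with t ht
    refine lt_of_eq_of_lt ?_ ht
    simp only [id]
    ring
  filter_upwards [exp_mul_min_le hlam a, hsmall, eventually_ge_atTop 1] with t hg hsm ht
  have ht0 : 0 < t := by linarith
  set s := lam * log t ^ 2 / t with hs
  have hs0 : 0 ≤ s := by positivity
  set W : ℤ → Ω → ℝ := fun i ω => min (max (c i * X i ω) 0) (t / 16) with hW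
  have hWm : ∀ i, AEMeasurable (W i) P := fun i =>
    (((hlaw i).aemeasurable.const_mul _).max aemeasurable_const).min aemeasurable_const
  have hWind : iIndepFun W P :=
    hindep.comp (fun i x => min (max (c i * x) 0) (t / 16)) fun i => by fun_prop
  have hF : ∀ F : Finset ℤ, P {ω | t < ∑ i ∈ F, W i ω}
      ≤ ENNReal.ofReal (exp 1 * exp (-(lam * log t ^ 2))) := by
    intro F
    rw [← ofReal_measureReal]
    refine ENNReal.ofReal_le_ofReal ?_
    have hbound : ∀ ω, ‖exp (s * (∑ i ∈ F, W i) ω)‖ ≤ exp (s * ∑ i ∈ F, t / 16) := by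
      intro ω
      rw [norm_of_nonneg (exp_pos _).le, Finset.sum_apply]
      refine exp_le_exp.2 (mul_le_mul_of_nonneg_left (Finset.sum_le_sum fun i _ => ?_) hs0)
      exact min_le_right _ _
    have hsumm : AEMeasurable (∑ i ∈ F, W i) P := Finset.aemeasurable_sum F fun i _ => hWm i
    have hI : Integrable (fun ω => exp (s * (∑ i ∈ F, W i) ω)) P :=
      Integrable.of_bound (hsumm.const_mul s).exp.aestronglyMeasurable _ (ae_of_all _ hbound)
    calc P.real {ω | t < ∑ i ∈ F, W i ω} ≤ P.real {ω | t ≤ (∑ i ∈ F, W i) ω} :=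
          measureReal_mono fun ω hω => by
            simp only [mem_ofPred_eq, Finset.sum_apply] at hω ⊢
            exact hω.le
      _ ≤ exp (-s * t) * mgf (∑ i ∈ F, W i) P s := measure_ge_le_exp_mul_mgf t hs0 hI
      _ ≤ exp (-s * t) * ∏ i ∈ F, exp (s * |c i| * K) := by
          rw [hWind.mgf_sum₀ hWm]
          gcongr with i _
          · exact fun i _ => mgf_nonneg
          · exact mgf_truncated_le (hlaw i) (ha i) hs0 (by positivity) hg hint
      _ ≤ exp (-s * t) * exp 1 := by
          rw [← exp_sum, ← Finset.sum_mul, ← Finset.mul_sum]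
          gcongr
          refine le_trans ?_ hsm.le
          rw [mul_assoc]
          gcongr
          exact hc.sum_le_tsum F fun i _ => abs_nonneg _
      _ = _ := by
          rw [mul_comm, hs]
          congr 2
          field_simp
  have hdir : Directed (· ⊆ ·) fun F : Finset ℤ => {ω | t < ∑ i ∈ F, W i ω} := by
    classical
    intro F G
    have hsub : ∀ F' ⊆ F ∪ G, {ω | t < ∑ i ∈ F', W i ω} ⊆ {ω | t < ∑ i ∈ F ∪ G, W i ω} :=
      fun F' hF' ω hω => by
        have hle : ∑ i ∈ F', W i ω ≤ ∑ i ∈ F ∪ G, W i ω :=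
          Finset.sum_le_sum_of_subset_of_nonneg hF' fun i _ _ =>
            le_min (le_max_right (c i * X i ω) 0) (by positivity)
        exact lt_of_lt_of_le hω hle
    exact ⟨F ∪ G, hsub F Finset.subset_union_left, hsub G Finset.subset_union_right⟩
  have hset : {ω | ∃ F : Finset ℤ, t < ∑ i ∈ F, min (max (c i * X i ω) 0) (t / 16)}
      = ⋃ F : Finset ℤ, {ω | t < ∑ i ∈ F, W i ω} := by
    ext ω; simp [hW]
  rw [hset, measureReal_def, hdir.measure_iUnion]
  exact ENNReal.toReal_le_of_le_ofReal (by positivity) (iSup_le hF)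

/-- Weights that are small in comparison with `b` produce a term larger than `t / 16` with a
probability which is negligible with respect to the tail at `t / b`. -/
lemma measureReal_exists_small_weight_le [IsProbabilityMeasure P] [IsProbabilityMeasure μ]
    (hlaw : ∀ i, HasLaw (X i) μ P) {c : ℤ → ℝ}
    (hc : Summable fun i => |c i|) {lam b p : ℝ} (hlam : 0 < lam) (hb : 0 < b) (hp : 0 ≤ p)
    (hi : hazardRate μ ~[atTop] fun t => lam * t⁻¹ * Real.log t)
    (habs : (fun t => μ.real {x | t < |x|}) =O[atTop] tail μ) :
    (fun t => P.real {ω | ∃ i, |c i| < exp (-(2 * p / lam)) / 16 * b ∧ t / 16 < c i * X i ω})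
      =O[atTop] fun t => (t / b) ^ (-p) * tail μ (t / b) := by
  obtain ⟨C, hC0, hC⟩ := habs.exists_nonneg
  obtain ⟨T₁, hT₁⟩ := eventually_atTop.1 hC.bound
  obtain ⟨T₂, hT₂1, hT₂⟩ := exists_tail_mul_le hlam hi (κ := lam / 2) (by linarith) (by linarith)
  set A := ∑' i, |c i| with hA
  have htb : Tendsto (fun t : ℝ => t / b) atTop atTop := tendsto_id.atTop_div_const hb
  refine IsBigO.of_bound (C * exp (2 * p / lam) * (16 / b) * A) ?_
  filter_upwards [htb.eventually_ge_atTop (max (max T₁ T₂) (exp (2 / lam))),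
    eventually_gt_atTop 0] with t htT ht0
  have hA0 : 0 ≤ A := tsum_nonneg fun i => abs_nonneg _
  have hT1' : T₁ ≤ t / b := (le_max_left _ _).trans ((le_max_left _ _).trans htT)
  have hT2' : T₂ ≤ t / b := (le_max_right _ _).trans ((le_max_left _ _).trans htT)
  have htb0 : 0 < t / b := by positivity
  have hL : 2 / lam ≤ log (t / b) := by
    rw [le_log_iff_exp_le htb0]
    exact (le_max_right _ _).trans htT
  have htail0 := tail_nonneg μ (t / b)
  have hterm : ∀ i, P {ω | |c i| < exp (-(2 * p / lam)) / 16 * b ∧ t / 16 < c i * X i ω}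
      ≤ ENNReal.ofReal (C * exp (2 * p / lam) * (16 / b)
        * ((t / b) ^ (-p) * tail μ (t / b)) * |c i|) := by
    intro i
    by_cases hsmall : |c i| < exp (-(2 * p / lam)) / 16 * b
    swap
    · simp [hsmall]
    rcases eq_or_ne (c i) 0 with h0 | h0
    · have : ¬ (t / 16 < 0) := by linarith
      simp [h0, this]
    have hci : 0 < |c i| := abs_pos.2 h0
    set u := b / (16 * |c i|) with hu
    have hu0 : 0 < u := by positivity
    have hueq : t / (16 * |c i|) = u * (t / b) := by rw [hu]; field_simp
    have hlogu : 2 * p / lam ≤ log u := by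
      rw [le_log_iff_exp_le hu0, hu, le_div_iff₀ (by positivity)]
      have h1 : exp (2 * p / lam) * exp (-(2 * p / lam)) = 1 := by
        rw [← exp_add, add_neg_cancel, exp_zero]
      calc exp (2 * p / lam) * (16 * |c i|)
          ≤ exp (2 * p / lam) * (16 * (exp (-(2 * p / lam)) / 16 * b)) := by gcongr
        _ = (exp (2 * p / lam) * exp (-(2 * p / lam))) * b := by ring
        _ = b := by rw [h1, one_mul]
    have hu1 : 1 ≤ u := by
      rw [← log_nonneg_iff hu0]
      exact le_trans (by positivity) hlogu
    rw [← ofReal_measureReal]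
    refine ENNReal.ofReal_le_ofReal ?_
    calc P.real {ω | |c i| < exp (-(2 * p / lam)) / 16 * b ∧ t / 16 < c i * X i ω}
        ≤ P.real {ω | u * (t / b) < |X i ω|} := by
          refine measureReal_mono fun ω hω => ?_
          have h1 : t / 16 < |c i| * |X i ω| :=
            hω.2.trans_le ((le_abs_self _).trans (abs_mul _ _).le)
          rw [mem_ofPred_eq, ← hueq, div_lt_iff₀ (by positivity)]
          linarith
      _ = μ.real {x | u * (t / b) < |x|} :=
          (hlaw i).measureReal_eq (p := fun x => u * (t / b) < |x|)
            (measurableSet_lt measurable_const measurable_norm)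
      _ ≤ C * tail μ (u * (t / b)) := by
          have h := hT₁ (u * (t / b)) (hT1'.trans (le_mul_of_one_le_left htb0.le hu1))
          rwa [norm_of_nonneg measureReal_nonneg, norm_of_nonneg (tail_nonneg _ _)] at h
      _ ≤ C * (tail μ (t / b) * exp (-(lam / 2 * log u * log (t / b)))) := by
          gcongr
          exact hT₂ _ hT2' u hu1
      _ ≤ C * (tail μ (t / b) * (exp (2 * p / lam) * (t / b) ^ (-p) * u⁻¹)) := by
          gcongr
          rw [rpow_def_of_pos htb0, ← exp_log (inv_pos.2 hu0), ← exp_add, ← exp_add, exp_le_exp,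
            log_inv]
          have h1 : 1 ≤ lam / 2 * log (t / b) := by
            rw [div_le_iff₀ hlam] at hL
            linarith
          have h2 : 2 * p / lam * (lam / 2) = p := by field_simp
          have h3 := mul_nonneg (sub_nonneg.2 hlogu) (sub_nonneg.2 h1)
          have h4 : 2 * p / lam * (lam / 2 * log (t / b)) = p * log (t / b) := by
            rw [← mul_assoc, h2]
          nlinarith
      _ = _ := by rw [hu]; field_simp
  have hset : {ω | ∃ i, |c i| < exp (-(2 * p / lam)) / 16 * b ∧ t / 16 < c i * X i ω}
      = ⋃ i, {ω | |c i| < exp (-(2 * p / lam)) / 16 * b ∧ t / 16 < c i * X i ω} := by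
    ext ω; simp
  have hr0 : 0 ≤ (t / b) ^ (-p) * tail μ (t / b) := by positivity
  rw [norm_of_nonneg measureReal_nonneg, norm_of_nonneg hr0, hset, measureReal_def]
  refine ENNReal.toReal_le_of_le_ofReal (by positivity) ?_
  refine (measure_iUnion_le _).trans ((ENNReal.tsum_le_tsum hterm).trans ?_)
  rw [← ENNReal.ofReal_tsum_of_nonneg (fun i => by positivity) (hc.mul_left _), tsum_mul_left]
  refine ENNReal.ofReal_le_ofReal (le_of_eq ?_)
  ring

end Sum

/-! ### Tails of multiples -/

section Multiples

variable {μ : Measure ℝ}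

lemma tail_mulLaw_eq (c t : ℝ) : tail (mulLaw c μ) t = μ.real {x | t < c * x} := by
  rw [tail, mulLaw, map_measureReal_apply (by fun_prop) measurableSet_Ioi]
  rfl

lemma tail_mulLaw_mul {r : ℝ} (hr : 0 < r) (c t : ℝ) :
    tail (mulLaw (c * r) μ) t = tail (mulLaw c μ) (t / r) := by
  rw [tail_mulLaw_eq, tail_mulLaw_eq]
  congr 1
  ext x
  rw [mem_ofPred_eq, mem_ofPred_eq, div_lt_iff₀ hr]
  ring_nf

lemma tail_mulLaw_of_pos {c : ℝ} (hc : 0 < c) (t : ℝ) : tail (mulLaw c μ) t = tail μ (t / c) := by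
  have h := tail_mulLaw_mul (μ := μ) hc 1 t
  rw [one_mul] at h
  rw [h, tail_mulLaw_eq]
  simp only [one_mul]
  rfl

lemma tail_mulLaw_of_neg {c : ℝ} (hc : c < 0) (t : ℝ) :
    tail (mulLaw c μ) t = tail (mulLaw (-1) μ) (t / |c|) := by
  have h := tail_mulLaw_mul (μ := μ) (abs_pos.2 hc.ne) (-1) t
  rwa [abs_of_neg hc, neg_one_mul, neg_neg, ← abs_of_neg hc] at h

lemma tail_mulLaw_zero {t : ℝ} (ht : 0 ≤ t) : tail (mulLaw 0 μ) t = 0 := by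
  rw [tail_mulLaw_eq]
  have : {x : ℝ | t < 0 * x} = ∅ := by
    ext x
    simp [ht]
  rw [this, measureReal_empty]

lemma isProbabilityMeasure_mulLaw [IsProbabilityMeasure μ] (c : ℝ) :
    IsProbabilityMeasure (mulLaw c μ) :=
  Measure.isProbabilityMeasure_map (by fun_prop)

lemma measureReal_abs_gt_le [IsFiniteMeasure μ] (t : ℝ) :
    μ.real {x | t < |x|} ≤ tail μ t + tail (mulLaw (-1) μ) t := by
  rw [tail_mulLaw_eq, tail]
  refine (measureReal_mono fun x hx => ?_).trans (measureReal_union_le _ _)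
  rw [mem_ofPred_eq, lt_abs] at hx
  rcases hx with h | h
  · exact Or.inl h
  · right
    rw [mem_ofPred_eq]
    linarith

/-- A weight is active if the tail of its multiple has the order of the upper tail of the
distribution, suitably rescaled. For a distribution bounded below, the active weights are the
positive ones; for a tail balanced one they are the nonzero ones. -/
def IsActive (μ : Measure ℝ) (c : ℝ) : Prop :=
  c ≠ 0 ∧ tail (mulLaw c μ) =Θ[atTop] fun t => tail μ (t / |c|)

lemma isActive_of_pos {c : ℝ} (hc : 0 < c) : IsActive μ c :=
  ⟨hc.ne', by
    rw [abs_of_pos hc, show tail (mulLaw c μ) = fun t => tail μ (t / c) from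
      funext (tail_mulLaw_of_pos hc)]⟩

lemma isActive_of_neg (h : tail (mulLaw (-1) μ) =Θ[atTop] tail μ) {c : ℝ} (hc : c < 0) :
    IsActive μ c := by
  refine ⟨hc.ne, ?_⟩
  have h1 : Tendsto (fun t : ℝ => t / |c|) atTop atTop :=
    tendsto_id.atTop_div_const (abs_pos.2 hc.ne)
  rw [show tail (mulLaw c μ) = fun t => tail (mulLaw (-1) μ) (t / |c|) from
      funext (tail_mulLaw_of_neg hc)]
  exact ⟨h.1.comp_tendsto h1, h.2.comp_tendsto h1⟩

lemma tail_mulLaw_eventuallyEq_zero_of_neg (h : tail (mulLaw (-1) μ) =ᶠ[atTop] 0) {c : ℝ}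
    (hc : c < 0) : tail (mulLaw c μ) =ᶠ[atTop] 0 := by
  have h1 : Tendsto (fun t : ℝ => t / |c|) atTop atTop :=
    tendsto_id.atTop_div_const (abs_pos.2 hc.ne)
  filter_upwards [h1.eventually h] with t ht
  rw [tail_mulLaw_of_neg hc, ht]
  rfl

lemma tail_mulLaw_zero_eventuallyEq : tail (mulLaw 0 μ) =ᶠ[atTop] 0 := by
  filter_upwards [eventually_ge_atTop 0] with t ht
  exact tail_mulLaw_zero ht

lemma TailLE.isBigO {a b : ℝ} (h : TailLE μ a b) :
    tail (mulLaw a μ) =O[atTop] tail (mulLaw b μ) := by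
  rcases h with h | ⟨ε, hε, h⟩
  · exact h.isBigO
  · refine IsBigO.of_bound ε⁻¹ ?_
    filter_upwards [h] with t ht
    rw [norm_of_nonneg (tail_nonneg _ _), norm_of_nonneg (tail_nonneg _ _), inv_mul_eq_div,
      le_div_iff₀ hε, mul_comm]
    exact ht.1

lemma TailLE.eventuallyEq_zero {a b : ℝ} (h : TailLE μ a b)
    (hb : tail (mulLaw b μ) =ᶠ[atTop] 0) : tail (mulLaw a μ) =ᶠ[atTop] 0 :=
  isBigO_zero_right_iff.1 (h.isBigO.trans hb.isBigO)

variable [IsProbabilityMeasure μ] {lam : ℝ}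

lemma isLittleO_tail_div (hlam : 0 < lam)
    (hi : hazardRate μ ~[atTop] fun t => lam * t⁻¹ * Real.log t) {a b : ℝ} (ha : 0 < a)
    (hab : a < b) : (fun t => tail μ (t / a)) =o[atTop] fun t => tail μ (t / b) := by
  have hb : 0 < b := ha.trans hab
  obtain ⟨T, hT1, hT⟩ := exists_tail_mul_le hlam hi (κ := lam / 2) (by linarith) (by linarith)
  have htb : Tendsto (fun t : ℝ => t / b) atTop atTop := tendsto_id.atTop_div_const hb
  have hu : 0 < log (b / a) := log_pos ((one_lt_div ha).2 hab)
  have hlim : Tendsto (fun t => exp (-(lam / 2 * log (b / a) * log (t / b)))) atTop (𝓝 0) := by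
    refine tendsto_exp_neg_atTop_nhds_zero.comp ?_
    exact (tendsto_log_atTop.comp htb).const_mul_atTop (by positivity)
  have hO : (fun t => tail μ (t / a)) =O[atTop]
      fun t => exp (-(lam / 2 * log (b / a) * log (t / b))) * tail μ (t / b) := by
    refine IsBigO.of_bound 1 ?_
    filter_upwards [htb.eventually_ge_atTop T] with t ht
    have h := hT (t / b) ht (b / a) ((one_lt_div ha).2 hab).le
    rw [show b / a * (t / b) = t / a by field_simp] at h
    have h1 := tail_nonneg μ (t / b)
    rw [norm_of_nonneg (tail_nonneg _ _), norm_of_nonneg (by positivity)]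
    linarith
  refine hO.trans_isLittleO ?_
  simpa using ((isLittleO_one_iff ℝ).2 hlim).mul_isBigO (isBigO_refl (fun t => tail μ (t / b)) atTop)

lemma IsActive.not_eventuallyEq_zero (hlam : 0 < lam)
    (hi : hazardRate μ ~[atTop] fun t => lam * t⁻¹ * Real.log t) {c : ℝ} (hc : IsActive μ c) :
    ¬ tail (mulLaw c μ) =ᶠ[atTop] 0 := by
  intro h
  have h1 := (hc.2.2.trans h.isBigO)
  have h2 := isBigO_zero_right_iff.1 h1
  obtain ⟨t, ht⟩ := h2.exists
  exact (tail_pos hlam hi _).ne' ht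

lemma IsActive.tailLE (hlam : 0 < lam)
    (hi : hazardRate μ ~[atTop] fun t => lam * t⁻¹ * Real.log t) {a b : ℝ} (ha : IsActive μ a)
    (hb : IsActive μ b) (hab : |a| ≤ |b|) : TailLE μ a b := by
  rcases hab.lt_or_eq with h | h
  · left
    exact ha.2.1.trans_isLittleO ((isLittleO_tail_div hlam hi (abs_pos.2 ha.1) h).trans_isBigO hb.2.2)
  · right
    have h1 := ha.2
    rw [h] at h1
    obtain ⟨C₁, hC₁, h₁⟩ := (h1.1.trans hb.2.2).exists_pos
    obtain ⟨C₂, hC₂, h₂⟩ := (hb.2.1.trans h1.2).exists_pos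
    refine ⟨(max C₁ C₂)⁻¹, by positivity, ?_⟩
    filter_upwards [h₁.bound, h₂.bound] with t h3 h4
    have h5 := tail_nonneg (mulLaw a μ) t
    have h6 := tail_nonneg (mulLaw b μ) t
    rw [norm_of_nonneg h5, norm_of_nonneg h6] at h3 h4
    rw [inv_inv, inv_mul_le_iff₀ (by positivity)]
    exact ⟨h3.trans (by gcongr; exact le_max_left _ _),
      h4.trans (by gcongr; exact le_max_right _ _)⟩

lemma TailLE.abs_le (hlam : 0 < lam)
    (hi : hazardRate μ ~[atTop] fun t => lam * t⁻¹ * Real.log t) {a b : ℝ} (h : TailLE μ a b)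
    (ha : IsActive μ a) (hb : IsActive μ b) : |a| ≤ |b| := by
  by_contra! hlt
  have h1 := hb.2.1.trans_isLittleO
    ((isLittleO_tail_div hlam hi (abs_pos.2 hb.1) hlt).trans_isBigO ha.2.2)
  have h2 := h.isBigO.trans_isLittleO h1
  exact isLittleO_irrefl (fun h3 => ha.not_eventuallyEq_zero hlam hi
    (h3.mono fun _ => not_not.1)) h2

lemma tendsto_logRate : Tendsto logRate atTop (𝓝 0) := by
  have := (isLittleO_log_id_atTop).tendsto_div_nhds_zero
  exact this

lemma logRate_pow_mul_rpow_isLittleO {j k : ℕ} {e b : ℝ} (hb : 0 < b) (h : (k : ℝ) < j + e) :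
    (fun t => logRate t ^ j * (t / b) ^ (-e)) =o[atTop] fun t => logRate t ^ k := by
  have h1 : (fun t : ℝ => log t ^ (j : ℝ)) =o[atTop] fun t => t ^ (j + e - k) :=
    isLittleO_log_rpow_rpow_atTop _ (by linarith)
  have h2 : (fun t => logRate t ^ j * (t / b) ^ (-e)) =ᶠ[atTop]
      fun t => b ^ e * (log t ^ (j : ℝ) * t ^ (-(j + e) : ℝ)) := by
    filter_upwards [eventually_gt_atTop 0] with t ht
    rw [div_rpow ht.le hb.le, rpow_neg hb.le, div_inv_eq_mul, logRate, div_pow, rpow_natCast,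
      neg_add, rpow_add ht, rpow_neg ht.le j, rpow_natCast]
    ring
  have h3 : (fun t : ℝ => t ^ (j + e - k) * t ^ (-(j + e) : ℝ)) =O[atTop]
      fun t => logRate t ^ k := by
    refine IsBigO.of_bound 1 ?_
    filter_upwards [eventually_ge_atTop (exp 1)] with t ht
    have ht0 : 0 < t := (exp_pos 1).trans_le ht
    have hl : 1 ≤ log t := by rwa [le_log_iff_exp_le ht0]
    rw [← rpow_add ht0, show (j + e - k + -(j + e) : ℝ) = -(k : ℝ) by ring, rpow_neg ht0.le,
      rpow_natCast, logRate, div_pow, norm_of_nonneg (by positivity),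
      norm_of_nonneg (by positivity), one_mul, inv_eq_one_div]
    gcongr
    exact one_le_pow₀ hl
  refine h2.trans_isLittleO (IsLittleO.const_mul_left ?_ _)
  exact (h1.mul_isBigO (isBigO_refl (fun t : ℝ => t ^ (-(j + e) : ℝ)) atTop)).trans_isBigO h3

/-- The tail at `t / a` loses the power `t ^ (-lam * log (b / a))` against the tail at `t / b`, and
each derivative loses a power `t ^ (-1)`, up to arbitrarily small powers. -/
lemma iteratedDeriv_isLittleO (hlam : 0 < lam)
    (hi : hazardRate μ ~[atTop] fun t => lam * t⁻¹ * Real.log t) {c b : ℝ} (hc : IsActive μ c)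
    {n j k : ℕ} (hs : SmoothTail (tail (mulLaw c μ)) n) (hj : j ≤ n) (hcb : |c| ≤ b)
    (hk : (k : ℝ) < j + lam * log (b / |c|)) :
    iteratedDeriv j (tail (mulLaw c μ)) =o[atTop] fun t => logRate t ^ k * tail μ (t / b) := by
  have hc0 : 0 < |c| := abs_pos.2 hc.1
  have hb : 0 < b := hc0.trans_le hcb
  have hl0 : 0 ≤ log (b / |c|) := log_nonneg ((one_le_div hc0).2 hcb)
  obtain ⟨κ, hκ0, hκ, hκk⟩ : ∃ κ, 0 ≤ κ ∧ κ < lam ∧ (k : ℝ) < j + κ * log (b / |c|) := by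
    have hcont : ContinuousAt (fun κ : ℝ => j + κ * log (b / |c|)) lam := by fun_prop
    have hev := (hcont.eventually (lt_mem_nhds hk)).and (lt_mem_nhds hlam)
    obtain ⟨κ, h1, h2⟩ := ((hev.filter_mono nhdsWithin_le_nhds).and
      (self_mem_nhdsWithin (s := Iio lam))).exists
    exact ⟨κ, h1.2.le, h2, h1.1⟩
  obtain ⟨T, hT1, hT⟩ := exists_tail_mul_le hlam hi hκ0 hκ
  have htb : Tendsto (fun t : ℝ => t / b) atTop atTop := tendsto_id.atTop_div_const hb
  have hO : (fun t => tail μ (t / |c|)) =O[atTop]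
      fun t => (t / b) ^ (-(κ * log (b / |c|))) * tail μ (t / b) := by
    refine IsBigO.of_bound 1 ?_
    filter_upwards [htb.eventually_ge_atTop T, eventually_gt_atTop 0] with t ht ht0
    have htb0 : 0 < t / b := by positivity
    have h := hT (t / b) ht (b / |c|) ((one_le_div hc0).2 hcb)
    rw [show b / |c| * (t / b) = t / |c| by field_simp] at h
    have h1 := tail_nonneg μ (t / b)
    rw [norm_of_nonneg (tail_nonneg _ _), norm_of_nonneg (by positivity), one_mul,
      rpow_def_of_pos htb0]
    refine h.trans (le_of_eq ?_)
    rw [mul_comm]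
    congr 2
    ring
  have h1 := (hs.isBigO j hj).trans
    ((isBigO_refl (fun t => logRate t ^ j) atTop).mul (hc.2.1.trans hO))
  refine h1.trans_isLittleO ?_
  have h2 := (logRate_pow_mul_rpow_isLittleO hb hκk).mul_isBigO
    (isBigO_refl (fun t => tail μ (t / b)) atTop)
  refine h2.congr_left fun t => ?_
  ring

end Multiples

/-! ### The expansion over finitely many weights -/

section Expansion

variable {Ω : Type*} [MeasurableSpace Ω] {P : Measure Ω} {μ : Measure ℝ}
  {X : ℤ → Ω → ℝ} {c : ℤ → ℝ} {lam : ℝ}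

lemma measureReal_gt_eq_tail_sumLaw (hlaw : ∀ i, HasLaw (X i) μ P)
    (hc : Summable fun i => |c i|) (hm : Integrable (fun x : ℝ => |x| ^ 1) μ) (t : ℝ) :
    P.real {ω | t < ∑' i, c i * X i ω} = tail (sumLaw P X c) t := by
  rw [tail, sumLaw, measureReal_def, measureReal_def, Measure.map_apply_of_aemeasurable
    (memLp_tsum hlaw hc one_ne_zero hm).aemeasurable measurableSet_Ioi]
  rfl

lemma integrable_abs_pow_mulLaw (hm : ∀ n : ℕ, Integrable (fun x : ℝ => |x| ^ n) μ) (a : ℝ)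
    (n : ℕ) : Integrable (fun x : ℝ => |x| ^ n) (mulLaw a μ) := by
  rw [mulLaw, integrable_map_measure (by fun_prop) (by fun_prop)]
  refine ((hm n).const_mul (|a| ^ n)).congr (ae_of_all _ fun x => ?_)
  simp only [Function.comp_apply]
  rw [abs_mul, mul_pow]

variable [IsProbabilityMeasure P] [IsProbabilityMeasure μ]

lemma exp_log_sq_isBigO (hlam : 0 < lam)
    (hi : hazardRate μ ~[atTop] fun t => lam * t⁻¹ * Real.log t) {b : ℝ} (hb : 0 < b) (p : ℝ) :
    (fun t => exp (-(lam * log t ^ 2))) =O[atTop] fun t => (t / b) ^ (-p) * tail μ (t / b) := by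
  have htb : Tendsto (fun t : ℝ => t / b) atTop atTop := tendsto_id.atTop_div_const hb
  have h1 := (exp_isBigO_tail hlam hi (κ := 3 / 2 * lam) (by linarith)).comp_tendsto htb
  have h2 : (fun t => exp (-(lam * log t ^ 2))) =O[atTop]
      fun t => (t / b) ^ (-p) * exp (-(3 / 2 * lam / 2 * log (t / b) ^ 2)) := by
    refine IsBigO.of_bound 1 ?_
    set B := |log b| with hB
    set D := |p| + 3 / 2 * lam * B + (|p| * B + 3 / 4 * lam * B ^ 2) with hD
    filter_upwards [tendsto_log_atTop.eventually_ge_atTop (max 1 (4 / lam * D)),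
      eventually_gt_atTop 0] with t hL ht0
    have hL1 : 1 ≤ log t := (le_max_left _ _).trans hL
    have hL2 : 4 / lam * D ≤ log t := (le_max_right _ _).trans hL
    have htb0 : 0 < t / b := by positivity
    rw [norm_of_nonneg (by positivity), norm_of_nonneg (by positivity), one_mul,
      rpow_def_of_pos htb0, ← exp_add, exp_le_exp, log_div ht0.ne' hb.ne']
    have hB0 : 0 ≤ B := abs_nonneg _
    have h3 : D ≤ lam / 4 * log t := by
      rw [div_mul_eq_mul_div, div_le_iff₀ hlam] at hL2
      linarith
    have h4 : D * log t ≤ lam / 4 * log t * log t := by gcongr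
    have h5 : |p| * B + 3 / 4 * lam * B ^ 2 ≤ (|p| * B + 3 / 4 * lam * B ^ 2) * log t :=
      le_mul_of_one_le_right (by positivity) hL1
    have h6 : |log t - log b| ≤ log t + B := (abs_sub _ _).trans (by rw [abs_of_pos (by linarith)])
    have h7 : (log t - log b) * p ≤ (log t + B) * |p| := by
      refine (le_abs_self _).trans ?_
      rw [abs_mul]
      gcongr
    have h8 : (log t - log b) ^ 2 ≤ (log t + B) ^ 2 := by
      rw [← sq_abs]
      gcongr
    have h9 : D * log t = (|p| + 3 / 2 * lam * B) * log t
        + (|p| * B + 3 / 4 * lam * B ^ 2) * log t := by rw [hD]; ring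
    nlinarith
  exact h2.trans ((isBigO_refl (fun t : ℝ => (t / b) ^ (-p)) atTop).mul h1)

lemma rpow_neg_isBigO_logRate {b : ℝ} (hb : 0 < b) (n : ℕ) :
    (fun t : ℝ => (t / b) ^ (-(n : ℝ))) =O[atTop] fun t => logRate t ^ n := by
  refine IsBigO.of_bound (b ^ n) ?_
  filter_upwards [eventually_ge_atTop (exp 1)] with t ht
  have ht0 : 0 < t := (exp_pos 1).trans_le ht
  have hl : 1 ≤ log t := by rwa [le_log_iff_exp_le ht0]
  rw [rpow_neg (by positivity), rpow_natCast, logRate, div_pow, div_pow,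
    norm_of_nonneg (by positivity), norm_of_nonneg (by positivity), inv_div, mul_div_assoc']
  gcongr
  exact le_mul_of_one_le_right (by positivity) (one_le_pow₀ hl)

/-- Without a term larger than `t / 16` among those with large weights, the sum exceeds `t` only if
a term with small weight is larger than `t / 16` or if the sum of the truncated terms is large. -/
lemma measureReal_no_large_isBigO (hindep : iIndepFun X P) (hlaw : ∀ i, HasLaw (X i) μ P)
    (hc : Summable fun i => |c i|) (hlam : 0 < lam)
    (hi : hazardRate μ ~[atTop] fun t => lam * t⁻¹ * Real.log t)
    (habs : (fun t => μ.real {x | t < |x|}) =O[atTop] tail μ) {b : ℝ} (hb : 0 < b) (n : ℕ)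
    {I : Finset ℤ} (hI : ∀ i ∉ I, |c i| < exp (-(2 * n / lam)) / 16 * b) :
    (fun t => P.real ({ω | t < ∑' i, c i * X i ω} ∩ ⋂ i ∈ I, {ω | t / 16 < c i * X i ω}ᶜ))
      =O[atTop] fun t => logRate t ^ n * tail μ (t / b) := by
  have hm1 := integrable_abs_pow hlam hi habs 1
  set a := 1 + ∑' i, |c i| with ha
  have hca : ∀ i, |c i| ≤ a := fun i => by
    have := hc.le_tsum i fun j _ => abs_nonneg _
    linarith
  have ha1 : 1 ≤ a := by
    have : 0 ≤ ∑' i, |c i| := tsum_nonneg fun i => abs_nonneg _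
    linarith
  have hint : Integrable (fun x => |x| * (2 + exp (lam / 4 * log (max (a * |x|) 1) ^ 2))) μ := by
    have h := (hm1.const_mul 2).add (integrable_pow_mul_exp_log_sq hlam hi habs 1 ha1)
    refine h.congr (ae_of_all _ fun x => ?_)
    simp only [Pi.add_apply, pow_one]
    ring
  have h1 := measureReal_exists_sum_truncated_gt_le hindep hlaw hc hlam hca hint
  have h2 := measureReal_exists_small_weight_le hlaw hc hlam hb (p := n) n.cast_nonneg hi habs
  have h3 := exp_log_sq_isBigO hlam hi hb (n : ℝ)
  have h4 := (rpow_neg_isBigO_logRate hb n).mul (isBigO_refl (fun t => tail μ (t / b)) atTop)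
  refine IsBigO.trans ?_ ((h2.add (h3.const_mul_left (exp 1))).trans h4)
  refine IsBigO.of_bound 1 ?_
  filter_upwards [h1] with t ht
  rw [norm_of_nonneg measureReal_nonneg, norm_of_nonneg (by positivity), one_mul]
  have hae : ({ω | t < ∑' i, c i * X i ω} ∩ ⋂ i ∈ I, {ω | t / 16 < c i * X i ω}ᶜ : Set Ω)
      ≤ᵐ[P] ({ω | ∃ i, |c i| < exp (-(2 * n / lam)) / 16 * b ∧ t / 16 < c i * X i ω}
        ∪ {ω | ∃ F : Finset ℤ, t < ∑ i ∈ F, min (max (c i * X i ω) 0) (t / 16)} : Set Ω) := by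
    filter_upwards [ae_summable hlaw hc hm1] with ω hs hω
    by_cases h : ∃ i, |c i| < exp (-(2 * n / lam)) / 16 * b ∧ t / 16 < c i * X i ω
    · exact Or.inl h
    right
    push Not at h
    have hle : ∀ i, c i * X i ω ≤ t / 16 := fun i => by
      by_cases hiI : i ∈ I
      · have := mem_iInter₂.1 hω.2 i hiI
        exact not_lt.1 this
      · exact h i (hI i hiI)
    obtain ⟨F, hF⟩ := (hs.hasSum.eventually (lt_mem_nhds hω.1)).exists
    exact ⟨F, hF.trans_le (Finset.sum_le_sum fun i _ => le_min (le_max_left _ _) (hle i))⟩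
  refine (ENNReal.toReal_mono (measure_ne_top _ _) (measure_mono_ae hae)).trans ?_
  exact (measureReal_union_le _ _).trans (add_le_add le_rfl ht)

lemma tail_isBigO_pow_neg {K : Measure ℝ} [IsFiniteMeasure K] (n : ℕ)
    (h : Integrable (fun x : ℝ => |x| ^ n) K) :
    tail K =O[atTop] fun t => (t ^ n)⁻¹ := by
  refine IsBigO.of_bound (∫ x, |x| ^ n ∂K) ?_
  filter_upwards [eventually_gt_atTop 0] with t ht
  rw [norm_of_nonneg (tail_nonneg _ _), norm_of_nonneg (by positivity), ← div_eq_mul_inv,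
    le_div_iff₀ (by positivity), mul_comm]
  refine le_trans ?_ (mul_meas_ge_le_integral_of_nonneg (ae_of_all _ fun x => by positivity) h (t ^ n))
  gcongr
  refine measureReal_mono fun x hx => ?_
  rw [mem_Ioi] at hx
  rw [mem_ofPred_eq]
  gcongr
  exact hx.le.trans (le_abs_self x)

/-- Two terms larger than `t / 16` contribute less than any power of `t` times the reference
tail. -/
lemma tail_mul_tail_isBigO {Q T : ℝ → ℝ} (hQ : SmoothTail Q 1) (hQT : Q =O[atTop] T)
    {K : Measure ℝ} [IsFiniteMeasure K] (hK : ∀ n : ℕ, Integrable (fun x : ℝ => |x| ^ n) K)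
    (n : ℕ) :
    (fun t => Q (t / 16) * tail K (t / 16)) =O[atTop] fun t => logRate t ^ n * T t := by
  obtain ⟨N, hN⟩ := hQ.exists_comp_mul_le le_rfl (θ := 1 / 16) (by norm_num) (by norm_num)
  have ht16 : Tendsto (fun t : ℝ => t / 16) atTop atTop :=
    tendsto_id.atTop_div_const (by norm_num)
  have h1 : (fun t => Q (t / 16)) =O[atTop] fun t => t ^ N * T t := by
    refine IsBigO.trans ?_ ((isBigO_refl (fun t : ℝ => t ^ N) atTop).mul hQT)
    refine IsBigO.of_bound 1 ?_
    filter_upwards [hN, eventually_ge_atTop 0] with t ht ht0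
    have := hQ.nonneg t
    rw [norm_of_nonneg (hQ.nonneg _), norm_of_nonneg (by positivity), one_mul]
    rwa [one_div_mul_eq_div] at ht
  have h2 := (tail_isBigO_pow_neg (N + n) (hK (N + n))).comp_tendsto ht16
  refine (h1.mul h2).trans ?_
  have h3 := (rpow_neg_isBigO_logRate one_pos n).mul (isBigO_refl T atTop)
  refine EventuallyEq.trans_isBigO ?_ (h3.const_mul_left (16 ^ (N + n)))
  filter_upwards [eventually_gt_atTop 0] with t ht
  simp only [Function.comp_apply, div_one]
  rw [rpow_neg ht.le, rpow_natCast, div_pow, pow_add]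
  field_simp

/-- The expansion to the full order `k` for all large weights, with an error of order `k + 1`. -/
theorem tail_sumLaw_sub_sum_isBigO (hindep : iIndepFun X P) (hlaw : ∀ i, HasLaw (X i) μ P)
    (hc : Summable fun i => |c i|) (hlam : 0 < lam)
    (hi : hazardRate μ ~[atTop] fun t => lam * t⁻¹ * Real.log t)
    (habs : (fun t => μ.real {x | t < |x|}) =O[atTop] tail μ) {b : ℝ} (hb : 0 < b) (k : ℕ)
    (hs : ∀ i, SmoothTail (tail (mulLaw (c i) μ)) (k + 1)) {T : ℝ → ℝ}
    (hT : ∀ i, tail (mulLaw (c i) μ) =O[atTop] T)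
    (hbT : (fun t => tail μ (t / b)) =O[atTop] T)
    {I : Finset ℤ} (hI : ∀ i ∉ I, |c i| < exp (-(2 * (k + 1 : ℕ) / lam)) / 16 * b) :
    (fun t => tail (sumLaw P X c) t - ∑ i ∈ I,
      laplaceCharacter (deletedLaw P X c i) k (tail (mulLaw (c i) μ)) t)
      =O[atTop] fun t => logRate t ^ (k + 1) * T t := by
  have hm := integrable_abs_pow hlam hi habs
  have hdel : ∀ i, IsProbabilityMeasure (deletedLaw P X c i) := fun i =>
    isProbabilityMeasure_sumLaw hlaw (summable_abs_update hc i) (hm 1)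
  have hprob : ∀ i, IsProbabilityMeasure (mulLaw (c i) μ) := fun i =>
    isProbabilityMeasure_mulLaw _
  have h1 := (measureReal_no_large_isBigO hindep hlaw hc hlam hi habs hb (k + 1) hI).trans
    ((isBigO_refl (fun t => logRate t ^ (k + 1)) atTop).mul hbT)
  have h2 : (fun t => ∑ i ∈ I, (∫ x, tail (mulLaw (c i) μ) (max (t - x) (1 / 16 * t))
        ∂(deletedLaw P X c i) - laplaceCharacter (deletedLaw P X c i) k (tail (mulLaw (c i) μ)) t))
      =O[atTop] fun t => logRate t ^ (k + 1) * T t := by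
    refine IsBigO.fun_sum fun i _ => ?_
    refine ((hs i).integral_sub_laplaceCharacter_isBigO (θ := 1 / 16) (by norm_num)
      (by norm_num) (deletedLaw P X c i)
      (fun n => integrable_pow_sumLaw hlaw (summable_abs_update hc i) hm n)).trans ?_
    exact (isBigO_refl (fun t => logRate t ^ (k + 1)) atTop).mul (hT i)
  have h3 : (fun t => ∑ i ∈ I, ∑ j ∈ I.erase i,
        P.real ({ω | t / 16 < c i * X i ω} ∩ {ω | t / 16 < c j * X j ω}))
      =O[atTop] fun t => logRate t ^ (k + 1) * T t := by
    refine IsBigO.fun_sum fun i _ => IsBigO.fun_sum fun j hj => ?_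
    have hij : i ≠ j := (Finset.ne_of_mem_erase hj).symm
    simp_rw [measureReal_large_and_large hindep hlaw hij]
    exact tail_mul_tail_isBigO ((hs i).of_le (by omega)) (hT i)
      (integrable_abs_pow_mulLaw hm _) _
  have h4 : (fun t => tail (sumLaw P X c) t
        - P.real ({ω | t < ∑' i, c i * X i ω} ∩ ⋂ i ∈ I, {ω | t / 16 < c i * X i ω}ᶜ)
        - ∑ i ∈ I, ∫ x, tail (mulLaw (c i) μ) (max (t - x) (1 / 16 * t)) ∂(deletedLaw P X c i))
      =O[atTop] fun t => logRate t ^ (k + 1) * T t := by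
    refine IsBigO.trans (IsBigO.of_bound 1 (Eventually.of_forall fun t => ?_)) h3
    have h := abs_measureReal_sub_sum_le P {ω | t < ∑' i, c i * X i ω}
      (fun i => {ω | t / 16 < c i * X i ω})
      (fun i => nullMeasurableSet_lt aemeasurable_const ((hlaw i).aemeasurable.const_mul _)) I
    rw [measureReal_gt_eq_tail_sumLaw hlaw hc (hm 1)] at h
    have h5 : ∀ i, P.real ({ω | t < ∑' i, c i * X i ω} ∩ {ω | t / 16 < c i * X i ω})
        = ∫ x, tail (mulLaw (c i) μ) (max (t - x) (1 / 16 * t)) ∂(deletedLaw P X c i) := fun i => by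
      rw [one_div_mul_eq_div, ← measureReal_sum_gt_and_large hindep hlaw hc (hm 1)]
      rfl
    simp_rw [h5] at h
    rw [one_mul]
    exact h.trans (le_abs_self _)
  refine ((h4.add h1).add h2).congr_left fun t => ?_
  rw [Finset.sum_sub_distrib]
  ring

end Expansion

/-! ### Truncation of the Laplace characters -/

lemma SmoothTail.eventually_contDiffAt {Q : ℝ → ℝ} {n : ℕ} (hQ : SmoothTail Q n) :
    ∀ᶠ t in atTop, ContDiffAt ℝ n Q t := by
  obtain ⟨t₀, h⟩ := hQ.contDiffOn
  filter_upwards [eventually_gt_atTop t₀] with t ht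
  exact h.contDiffAt (Ioi_mem_nhds ht)

lemma summable_abs_of_summable_rpow {c : ℤ → ℝ} {δ : ℝ} (hδ : 0 < δ) (hδ1 : δ < 1)
    (h : Summable fun i => |c i| ^ δ) : Summable fun i => |c i| := by
  refine Summable.of_norm_bounded_eventually h ?_
  filter_upwards [h.tendsto_cofinite_zero.eventually (gt_mem_nhds zero_lt_one)] with i hi
  rw [norm_of_nonneg (abs_nonneg _)]
  have h1 : |c i| ≤ 1 := by
    by_contra! hgt
    exact absurd hi (not_lt.2 (one_le_rpow hgt.le hδ.le))
  rcases (abs_nonneg (c i)).eq_or_lt with h0 | h0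
  · rw [← h0]; positivity
  · calc |c i| = |c i| ^ (1 : ℝ) := (rpow_one _).symm
      _ ≤ |c i| ^ δ := rpow_le_rpow_of_exponent_ge h0 h1 hδ1.le

section Main

variable {Ω : Type*} [MeasurableSpace Ω] {P : Measure Ω} {μ : Measure ℝ}
  {X : ℤ → Ω → ℝ} {c : ℤ → ℝ} {lam : ℝ}

variable [IsProbabilityMeasure P] [IsProbabilityMeasure μ]

lemma IsActive.mul_pos {a r : ℝ} (ha : IsActive μ a) (hr : 0 < r) (hlam : 0 < lam)
    (hi : hazardRate μ ~[atTop] fun t => lam * t⁻¹ * Real.log t)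
    (hdich : ∀ a, IsActive μ a ∨ tail (mulLaw a μ) =ᶠ[atTop] 0) : IsActive μ (a * r) := by
  refine (hdich _).resolve_right fun h => ha.not_eventuallyEq_zero hlam hi ?_
  have h1 : Tendsto (fun t : ℝ => t * r) atTop atTop := tendsto_id.atTop_mul_const hr
  filter_upwards [h1.eventually h] with t ht
  rwa [tail_mulLaw_mul hr, mul_div_cancel_right₀ _ hr.ne'] at ht

/-- Terms of order `j` in the Laplace character of the weight `a` are negligible as soon as
`j + lam * log |b / a|` exceeds the order `k` of the expansion. -/
lemma laplaceCharacter_sub_isLittleO (hlam : 0 < lam)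
    (hi : hazardRate μ ~[atTop] fun t => lam * t⁻¹ * Real.log t) {a b : ℝ} (ha : IsActive μ a)
    {k : ℕ} (hs : SmoothTail (tail (mulLaw a μ)) (k + 1)) (hab : |a| ≤ |b|) {p : ℤ}
    (hp : (k : ℝ) < p + 1 + lam * log (|b| / |a|)) (hpk : p ≤ k)
    (K : Measure ℝ) :
    (fun t => laplaceCharacter K k (tail (mulLaw a μ)) t
        - laplaceCharacter K p (tail (mulLaw a μ)) t)
      =o[atTop] fun t => logRate t ^ k * tail μ (t / |b|) := by
  have hsub : ∀ t, laplaceCharacter K k (tail (mulLaw a μ)) t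
        - laplaceCharacter K p (tail (mulLaw a μ)) t
      = ∑ j ∈ Finset.Ico (p + 1).toNat (k + 1), (-1 : ℝ) ^ j / (j.factorial : ℝ) * (∫ x, x ^ j ∂K)
        * iteratedDeriv j (tail (mulLaw a μ)) t := by
    intro t
    rw [Finset.sum_Ico_eq_sub _ (by omega), laplaceCharacter, laplaceCharacter]
    rw [show ((k : ℤ) + 1).toNat = k + 1 by omega]
  simp_rw [hsub]
  refine IsLittleO.fun_sum fun j hj => IsLittleO.const_mul_left ?_ _
  rw [Finset.mem_Ico] at hj
  refine iteratedDeriv_isLittleO hlam hi ha hs (by omega) hab ?_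
  have h1 : p + 1 ≤ j := by omega
  have h2 : (p : ℝ) + 1 ≤ j := by exact_mod_cast h1
  linarith

open Classical in
/-- The expansion when the maximal weight is active, so that the reference tail does not vanish. -/
theorem expansion_of_isActive (hindep : iIndepFun X P) (hlaw : ∀ i, HasLaw (X i) μ P)
    (hc : Summable fun i => |c i|) (hlam : 0 < lam)
    (hi : hazardRate μ ~[atTop] fun t => lam * t⁻¹ * Real.log t)
    (habs : (fun t => μ.real {x | t < |x|}) =O[atTop] tail μ) {k : ℕ}
    (hs : ∀ a, SmoothTail (tail (mulLaw a μ)) (k + 1))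
    (hdich : ∀ a, IsActive μ a ∨ tail (mulLaw a μ) =ᶠ[atTop] 0) {i₀ : ℤ}
    (hact : IsActive μ (c i₀)) (hmax : ∀ i, TailLE μ (c i) (c i₀)) :
    (∀ᶠ t in atTop, Summable fun i : ℤ =>
      if TailLE μ (c i₀ * Real.exp (-(k : ℝ) / lam)) (c i) then
        laplaceCharacter (deletedLaw P X c i) ((k : ℤ) + ⌊lam * Real.log |c i / c i₀|⌋)
          (tail (mulLaw (c i) μ)) t
      else 0) ∧
    (fun t => tail (sumLaw P X c) t - ∑' i : ℤ,
      if TailLE μ (c i₀ * Real.exp (-(k : ℝ) / lam)) (c i) then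
        laplaceCharacter (deletedLaw P X c i) ((k : ℤ) + ⌊lam * Real.log |c i / c i₀|⌋)
          (tail (mulLaw (c i) μ)) t
      else 0)
      =o[atTop] (fun t => hazardRate μ t ^ k * tail (mulLaw (c i₀) μ) t) := by
  set b := |c i₀| with hb
  have hb0 : 0 < b := abs_pos.2 hact.1
  -- small enough for the union bound over the small weights, and below `exp (-k / lam)`
  set η : ℝ := exp (-(2 * (k + 1 : ℕ) / lam)) / 16 with hη
  have hη0 : 0 < η := by positivity
  have hηk : η < exp (-(k : ℝ) / lam) := by
    have h1 : exp (-(2 * (k + 1 : ℕ) / lam)) ≤ exp (-(k : ℝ) / lam) := by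
      rw [exp_le_exp, neg_div, neg_le_neg_iff]
      gcongr
      push_cast
      linarith [(Nat.cast_nonneg k : (0 : ℝ) ≤ k)]
    have h2 := exp_pos (-(2 * (k + 1 : ℕ) / lam))
    rw [hη]
    linarith
  have hact' : IsActive μ (c i₀ * exp (-(k : ℝ) / lam)) :=
    hact.mul_pos (exp_pos _) hlam hi hdich
  have habs' : |c i₀ * exp (-(k : ℝ) / lam)| = b * exp (-(k : ℝ) / lam) := by
    rw [abs_mul, abs_of_pos (exp_pos _)]
  -- the weights that enter the expansion
  have hLE : ∀ i, TailLE μ (c i₀ * exp (-(k : ℝ) / lam)) (c i) →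
      IsActive μ (c i) ∧ b * exp (-(k : ℝ) / lam) ≤ |c i| := by
    intro i h
    have h1 : IsActive μ (c i) := (hdich _).resolve_right fun h0 =>
      hact'.not_eventuallyEq_zero hlam hi (h.eventuallyEq_zero h0)
    exact ⟨h1, habs' ▸ h.abs_le hlam hi hact' h1⟩
  obtain ⟨I, hI⟩ : ∃ I : Finset ℤ, ∀ i ∉ I, |c i| < η * b := by
    have h := hc.tendsto_cofinite_zero.eventually (gt_mem_nhds (by positivity : 0 < η * b))
    rw [Filter.eventually_cofinite] at h
    exact ⟨h.toFinset, fun i hi => by simpa using hi⟩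
  have hzero : ∀ t, ∀ i ∉ I, (if TailLE μ (c i₀ * Real.exp (-(k : ℝ) / lam)) (c i) then
        laplaceCharacter (deletedLaw P X c i) ((k : ℤ) + ⌊lam * Real.log |c i / c i₀|⌋)
          (tail (mulLaw (c i) μ)) t else 0) = 0 := by
    intro t i hiI
    refine if_neg fun h => ?_
    have h1 := (hLE i h).2
    have h2 := hI i hiI
    nlinarith
  refine ⟨Eventually.of_forall fun t => summable_of_ne_finset_zero (hzero t), ?_⟩
  have hmain := tail_sumLaw_sub_sum_isBigO hindep hlaw hc hlam hi habs hb0 k (fun i => hs (c i))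
    (fun i => (hmax i).isBigO) hact.2.2 hI
  -- the terms of the characters of order `k` that are left out
  have hdrop : ∀ i, (fun t => laplaceCharacter (deletedLaw P X c i) k (tail (mulLaw (c i) μ)) t
      - if TailLE μ (c i₀ * Real.exp (-(k : ℝ) / lam)) (c i) then
        laplaceCharacter (deletedLaw P X c i) ((k : ℤ) + ⌊lam * Real.log |c i / c i₀|⌋)
          (tail (mulLaw (c i) μ)) t else 0)
      =o[atTop] fun t => logRate t ^ k * tail μ (t / b) := by
    intro i
    rcases hdich (c i) with ha | h0
    · have hle : |c i| ≤ b := (hmax i).abs_le hlam hi ha hact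
      have hi0 : 0 < |c i| := abs_pos.2 ha.1
      have hlog : log |c i / c i₀| = -log (b / |c i|) := by
        rw [abs_div, log_div hi0.ne' hb0.ne', log_div hb0.ne' hi0.ne']
        ring
      have hl0 : 0 ≤ log (b / |c i|) := log_nonneg ((one_le_div hi0).2 hle)
      by_cases h : TailLE μ (c i₀ * Real.exp (-(k : ℝ) / lam)) (c i)
      · simp only [if_pos h]
        have hfl := Int.lt_floor_add_one (lam * log |c i / c i₀|)
        have hfl0 : ⌊lam * log |c i / c i₀|⌋ ≤ 0 := by
          rw [← Int.floor_zero (R := ℝ)]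
          refine Int.floor_le_floor ?_
          rw [hlog]
          nlinarith [mul_nonneg hlam.le hl0]
        refine laplaceCharacter_sub_isLittleO hlam hi ha (hs _) hle ?_ (by omega) _
        push_cast
        rw [hlog] at hfl ⊢
        linarith
      · have hlt : |c i| < b * exp (-(k : ℝ) / lam) := by
          by_contra! hge
          exact h (hact'.tailLE hlam hi ha (habs' ▸ hge))
        have hlog2 : (k : ℝ) < lam * log (b / |c i|) := by
          have h1 : exp (k / lam) < b / |c i| := by
            rw [lt_div_iff₀ hi0]
            have h2 : exp (k / lam) * exp (-(k : ℝ) / lam) = 1 := by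
              rw [← exp_add, neg_div, add_neg_cancel, exp_zero]
            calc exp (k / lam) * |c i| < exp (k / lam) * (b * exp (-(k : ℝ) / lam)) := by gcongr
              _ = exp (k / lam) * exp (-(k : ℝ) / lam) * b := by ring
              _ = b := by rw [h2, one_mul]
          have h3 := (lt_log_iff_exp_lt (by positivity)).2 h1
          rw [div_lt_iff₀ hlam] at h3
          linarith
        -- leaving out the weight amounts to a character of order `-1`
        have hempty : ∀ t, laplaceCharacter (deletedLaw P X c i) (-1) (tail (mulLaw (c i) μ)) t
            = 0 := fun t => by simp [laplaceCharacter]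
        simp only [if_neg h]
        have := laplaceCharacter_sub_isLittleO hlam hi ha (hs _) hle (p := -1)
          (by push_cast; linarith) (by omega) (deletedLaw P X c i)
        simpa only [hempty] using this
    · have h : ¬ TailLE μ (c i₀ * Real.exp (-(k : ℝ) / lam)) (c i) := fun h =>
        (hLE i h).1.not_eventuallyEq_zero hlam hi h0
      simp only [if_neg h, sub_zero]
      refine EventuallyEq.trans_isLittleO ?_ (isLittleO_zero _ _)
      have h1 : ∀ᶠ t in atTop, ∀ j ∈ Finset.range ((k : ℤ) + 1).toNat,
          iteratedDeriv j (tail (mulLaw (c i) μ)) t = 0 :=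
        (Filter.eventually_all_finset _).2 fun j _ => iteratedDeriv_eventuallyEq_zero h0 j
      filter_upwards [h1] with t ht
      exact Finset.sum_eq_zero fun j hj => by rw [ht j hj, mul_zero]
  have hrate : (fun t => logRate t ^ k * tail (mulLaw (c i₀) μ) t) =O[atTop]
      fun t => hazardRate μ t ^ k * tail (mulLaw (c i₀) μ) t := by
    have h1 : logRate =O[atTop] hazardRate μ := by
      refine (hi.symm.isBigO.const_mul_left lam⁻¹).congr_left fun t => ?_
      rw [logRate]
      field_simp
    exact (h1.pow k).mul (isBigO_refl _ _)
  have h1 : (fun t => logRate t ^ (k + 1) * tail (mulLaw (c i₀) μ) t) =o[atTop]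
      fun t => logRate t ^ k * tail (mulLaw (c i₀) μ) t := by
    have := ((isLittleO_one_iff ℝ).2 tendsto_logRate).mul_isBigO
      (isBigO_refl (fun t => logRate t ^ k * tail (mulLaw (c i₀) μ) t) atTop)
    refine this.congr (fun t => ?_) (fun t => one_mul _)
    ring
  have h2 : (fun t => logRate t ^ k * tail μ (t / b)) =O[atTop]
      fun t => logRate t ^ k * tail (mulLaw (c i₀) μ) t :=
    (isBigO_refl _ _).mul hact.2.2
  have h3 := (hmain.trans_isLittleO h1).add
    ((IsLittleO.fun_sum fun i (_ : i ∈ I) => hdrop i).trans_isBigO h2)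
  refine (h3.trans_isBigO hrate).congr_left fun t => ?_
  rw [tsum_eq_sum (hzero t), Finset.sum_sub_distrib]
  ring

end Main

/-! ### The two alternatives for the lower tail -/

section LowerTail

variable {Ω : Type*} [MeasurableSpace Ω] {P : Measure Ω} {μ : Measure ℝ}
  {X : ℤ → Ω → ℝ} {c : ℤ → ℝ}

lemma tail_reflected_eventuallyEq_zero [IsProbabilityMeasure μ]
    (h : ∀ᶠ x in atBot, cdf μ x = 0) :
    tail (mulLaw (-1) μ) =ᶠ[atTop] 0 := by
  filter_upwards [tendsto_neg_atTop_atBot.eventually h] with t ht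
  rw [cdf_eq_real] at ht
  rw [tail_mulLaw_eq, Pi.zero_apply]
  refine le_antisymm ((measureReal_mono fun x hx => ?_).trans ht.le) measureReal_nonneg
  rw [mem_ofPred_eq] at hx
  rw [mem_Iic]
  linarith

lemma TailBalanced.isTheta (h : TailBalanced μ) (hpos : ∀ t, 0 < tail μ t)
    (hneg : ∀ t, 0 < tail (mulLaw (-1) μ) t) : tail (mulLaw (-1) μ) =Θ[atTop] tail μ := by
  obtain ⟨l, hl, h⟩ := h
  constructor
  · have h2 := h.inv₀ hl.ne'
    refine isBigO_of_div_tendsto_nhds (Eventually.of_forall fun t ht => absurd ht (hpos t).ne')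
      l⁻¹ (h2.congr fun t => ?_)
    rw [inv_div]
    rfl
  · exact isBigO_of_div_tendsto_nhds
      (Eventually.of_forall fun t ht => absurd ht (hneg t).ne') l h

/-- If the distribution is bounded below and all weights are nonpositive, then the sum is bounded
above. -/
lemma tail_sumLaw_eventuallyEq_zero [IsProbabilityMeasure P]
    (h : tail (mulLaw (-1) μ) =ᶠ[atTop] 0)
    (hlaw : ∀ i, HasLaw (X i) μ P) (hc : Summable fun i => |c i|)
    (hm : Integrable (fun x : ℝ => |x| ^ 1) μ) (hneg : ∀ i, c i ≤ 0) :
    tail (sumLaw P X c) =ᶠ[atTop] 0 ∧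
      ∀ᶠ t in atTop, ∀ i, ∀ j, iteratedDeriv j (tail (mulLaw (c i) μ)) t = 0 := by
  obtain ⟨A, hA⟩ := eventually_atTop.1 (h.and (eventually_ge_atTop 0))
  have hA0 : 0 ≤ A := (hA A le_rfl).2
  have hzero : ∀ t ≥ A, tail (mulLaw (-1) μ) t = 0 := fun t ht => (hA t ht).1
  set S := ∑' i, |c i| with hS
  have hcS : ∀ i, |c i| ≤ S := fun i => hc.le_tsum i fun j _ => abs_nonneg _
  constructor
  · filter_upwards [eventually_ge_atTop (A * S)] with t ht
    rw [← measureReal_gt_eq_tail_sumLaw hlaw hc hm, Pi.zero_apply, measureReal_def]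
    have hae : ∀ᵐ ω ∂P, ∀ i, -A ≤ X i ω := by
      refine ae_all_iff.2 fun i => ?_
      have h1 : P.real {ω | A < -1 * X i ω} = 0 := by
        rw [tail_mulLaw hlaw, hzero A le_rfl]
      rw [measureReal_eq_zero_iff] at h1
      rw [ae_iff]
      refine measure_mono_null (fun ω hω => ?_) h1
      rw [mem_ofPred_eq] at hω ⊢
      linarith
    have h0 : P {ω | t < ∑' i, c i * X i ω} = 0 := by
      rw [← compl_compl {ω | t < ∑' i, c i * X i ω}, ← mem_ae_iff]
      filter_upwards [hae, ae_summable hlaw hc hm] with ω h1 h2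
      rw [mem_compl_iff, mem_ofPred_eq, not_lt]
      refine le_trans ?_ ht
      rw [hS, ← tsum_mul_left]
      refine h2.tsum_le_tsum (fun i => ?_) (hc.mul_left A)
      rw [abs_of_nonpos (hneg i)]
      nlinarith [hneg i, h1 i]
    rw [h0, ENNReal.toReal_zero]
  · filter_upwards [eventually_gt_atTop (A * S)] with t ht i j
    have hev : tail (mulLaw (c i) μ) =ᶠ[𝓝 t] fun _ => 0 := by
      filter_upwards [Ioi_mem_nhds ht] with s hs
      rw [mem_Ioi] at hs
      have hs0 : 0 ≤ s := le_trans (mul_nonneg hA0 ((abs_nonneg _).trans (hcS i))) hs.le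
      rcases (hneg i).lt_or_eq with h1 | h1
      · rw [tail_mulLaw_of_neg h1]
        refine hzero _ ?_
        rw [ge_iff_le, le_div_iff₀ (abs_pos.2 h1.ne)]
        exact (mul_le_mul_of_nonneg_left (hcS i) hA0).trans hs.le
      · rw [h1, tail_mulLaw_zero hs0]
    rw [hev.iteratedDeriv_eq]
    simp

end LowerTail

end WeightedConvolution

end

open WeightedConvolution Classical in
theorem theorem2p3p3
    -- independent random variables `X i` with common distribution `μ`
    {Ω : Type*} [MeasurableSpace Ω] (P : Measure Ω) [IsProbabilityMeasure P]
    (μ : Measure ℝ) [IsProbabilityMeasure μ]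
    (X : ℤ → Ω → ℝ) (hindep : iIndepFun X P) (hlaw : ∀ i, HasLaw (X i) μ P)
    (c : ℤ → ℝ) (m : ℕ) (lam : ℝ) (hlam : 0 < lam)
    -- (i) and (ii) for the hazard rate, and the standard conditions
    (hi : hazardRate μ ~[atTop] fun t => lam * t⁻¹ * Real.log t)
    (hii : SmoothlyVarying (hazardRate μ) (-1) m)
    (hstd : StandardConditions μ c fun h =>
      (h ~[atTop] fun t => lam * t⁻¹ * Real.log t) ∧ SmoothlyVarying h (-1) m)
    -- `c i₀` is a maximal weight, for the ordering by tails
    (i₀ : ℤ) (hmax : ∀ i, TailLE μ (c i) (c i₀)) (hne : c i₀ ≠ 0)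
    (k : ℕ) (hk : 1 ≤ k) (hkm : k ≤ m) :
    -- the weighted sum, the moments, the derivatives and the sum over `i` are well defined
    (∀ᵐ ω ∂P, Summable fun i => c i * X i ω) ∧
    (∀ (i : ℤ) (n : ℕ), Integrable (fun x : ℝ => x ^ n) (deletedLaw P X c i)) ∧
    (∀ i : ℤ, ∀ᶠ t in atTop, ContDiffAt ℝ m (tail (mulLaw (c i) μ)) t) ∧
    (∀ᶠ t in atTop, Summable fun i : ℤ =>
      if TailLE μ (c i₀ * Real.exp (-(k : ℝ) / lam)) (c i) then
        laplaceCharacter (deletedLaw P X c i) ((k : ℤ) + ⌊lam * Real.log |c i / c i₀|⌋)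
          (tail (mulLaw (c i) μ)) t
      else 0) ∧
    -- the expansion
    (fun t => tail (sumLaw P X c) t - ∑' i : ℤ,
      if TailLE μ (c i₀ * Real.exp (-(k : ℝ) / lam)) (c i) then
        laplaceCharacter (deletedLaw P X c i) ((k : ℤ) + ⌊lam * Real.log |c i / c i₀|⌋)
          (tail (mulLaw (c i) μ)) t
      else 0)
      =o[atTop] (fun t => hazardRate μ t ^ k * tail (mulLaw (c i₀) μ) t) := by
  obtain ⟨⟨δ, hδ0, hδ1, hδ⟩, hcase⟩ := hstd
  have hc := summable_abs_of_summable_rpow hδ0 hδ1 hδ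
  have hpos := tail_pos hlam hi
  have hprob : ∀ a, IsProbabilityMeasure (mulLaw a μ) := isProbabilityMeasure_mulLaw
  have hsp : ∀ a, 0 < a → SmoothTail (tail (mulLaw a μ)) (m + 1) := fun a ha => by
    rw [show tail (mulLaw a μ) = fun t => tail μ (t / a) from funext (tail_mulLaw_of_pos ha)]
    exact (smoothTail_tail μ hlam hi hii).comp_div ha
  have hs0 : SmoothTail (tail (mulLaw 0 μ)) (m + 1) :=
    smoothTail_of_eventuallyEq_zero (tail_antitone _) (tail_nonneg _)
      tail_mulLaw_zero_eventuallyEq _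
  have habs_of : tail (mulLaw (-1) μ) =O[atTop] tail μ →
      (fun t => μ.real {x | t < |x|}) =O[atTop] tail μ := fun h => by
    refine IsBigO.trans (IsBigO.of_bound 1 (Eventually.of_forall fun t => ?_))
      ((isBigO_refl (tail μ) atTop).add h)
    rw [Real.norm_of_nonneg measureReal_nonneg, one_mul]
    exact (measureReal_abs_gt_le t).trans (le_abs_self _)
  have hdef : (fun t => μ.real {x | t < |x|}) =O[atTop] tail μ →
      (∀ a < 0, SmoothTail (tail (mulLaw a μ)) (m + 1)) →
      (∀ᵐ ω ∂P, Summable fun i => c i * X i ω) ∧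
      (∀ (i : ℤ) (n : ℕ), Integrable (fun x : ℝ => x ^ n) (deletedLaw P X c i)) ∧
      (∀ i : ℤ, ∀ᶠ t in atTop, ContDiffAt ℝ m (tail (mulLaw (c i) μ)) t) := by
    intro habs hsn
    have hm := integrable_abs_pow hlam hi habs
    refine ⟨ae_summable hlaw hc (hm 1),
      fun i n => integrable_pow_sumLaw hlaw (summable_abs_update hc i) hm n, fun i => ?_⟩
    have : SmoothTail (tail (mulLaw (c i) μ)) (m + 1) := by
      rcases lt_trichotomy (c i) 0 with h | h | h
      · exact hsn _ h
      · rw [h]; exact hs0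
      · exact hsp _ h
    exact (this.of_le (Nat.le_succ m)).eventually_contDiffAt
  have hall : (∀ a < 0, SmoothTail (tail (mulLaw a μ)) (m + 1)) →
      ∀ a, SmoothTail (tail (mulLaw a μ)) (k + 1) := fun h a => by
    rcases lt_trichotomy a 0 with h0 | h0 | h0
    · exact (h a h0).of_le (by omega)
    · rw [h0]; exact hs0.of_le (by omega)
    · exact (hsp a h0).of_le (by omega)
  rcases hcase with hF | ⟨hbal, hi', hii'⟩
  · have h0 := tail_reflected_eventuallyEq_zero hF
    have habs := habs_of (h0.trans_isBigO (isBigO_zero _ _))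
    have hsn : ∀ a < 0, SmoothTail (tail (mulLaw a μ)) (m + 1) := fun a ha =>
      smoothTail_of_eventuallyEq_zero (tail_antitone _) (tail_nonneg _)
        (tail_mulLaw_eventuallyEq_zero_of_neg h0 ha) _
    have hdich : ∀ a, IsActive μ a ∨ tail (mulLaw a μ) =ᶠ[atTop] 0 := fun a => by
      rcases lt_trichotomy a 0 with h | h | h
      · exact Or.inr (tail_mulLaw_eventuallyEq_zero_of_neg h0 h)
      · rw [h]; exact Or.inr tail_mulLaw_zero_eventuallyEq
      · exact Or.inl (isActive_of_pos h)
    obtain ⟨hsum, hmom, hdiff⟩ := hdef habs hsn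
    refine ⟨hsum, hmom, hdiff, ?_⟩
    rcases hne.lt_or_gt with hlt | hgt
    · -- all weights are nonpositive, and both sides vanish ultimately
      have hneg : ∀ i, c i ≤ 0 := fun i => by
        by_contra! h
        exact (isActive_of_pos h).not_eventuallyEq_zero hlam hi
          ((hmax i).eventuallyEq_zero (tail_mulLaw_eventuallyEq_zero_of_neg h0 hlt))
      obtain ⟨h1, h2⟩ := tail_sumLaw_eventuallyEq_zero h0 hlaw hc
        (integrable_abs_pow hlam hi habs 1) hneg
      have h3 : ∀ᶠ t in atTop, ∀ i, (if TailLE μ (c i₀ * Real.exp (-(k : ℝ) / lam)) (c i) then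
          laplaceCharacter (deletedLaw P X c i) ((k : ℤ) + ⌊lam * Real.log |c i / c i₀|⌋)
            (tail (mulLaw (c i) μ)) t else 0) = 0 := by
        filter_upwards [h2] with t ht i
        split_ifs
        · exact Finset.sum_eq_zero fun j _ => by rw [ht i j, mul_zero]
        · rfl
      constructor
      · filter_upwards [h3] with t ht
        simp only [ht]
        exact summable_zero
      · refine EventuallyEq.trans_isLittleO ?_ (isLittleO_zero _ _)
        filter_upwards [h1, h3] with t ht1 ht3
        simp only [ht1, ht3, tsum_zero]
        simp
    · exact expansion_of_isActive hindep hlaw hc hlam hi habs (hall hsn) hdich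
        (isActive_of_pos hgt) hmax
  · have hpos' := tail_pos (μ := mulLaw (-1) μ) hlam hi'
    have hθ := hbal.isTheta hpos hpos'
    have habs := habs_of hθ.1
    have hsn : ∀ a < 0, SmoothTail (tail (mulLaw a μ)) (m + 1) := fun a ha => by
      rw [show tail (mulLaw a μ) = fun t => tail (mulLaw (-1) μ) (t / |a|) from
        funext (tail_mulLaw_of_neg ha)]
      exact (smoothTail_tail (mulLaw (-1) μ) hlam hi' hii').comp_div (abs_pos.2 ha.ne)
    have hnz : ∀ a, a ≠ 0 → IsActive μ a := fun a ha =>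
      ha.lt_or_gt.elim (isActive_of_neg hθ) isActive_of_pos
    have hdich : ∀ a, IsActive μ a ∨ tail (mulLaw a μ) =ᶠ[atTop] 0 := fun a => by
      rcases eq_or_ne a 0 with h | h
      · rw [h]; exact Or.inr tail_mulLaw_zero_eventuallyEq
      · exact Or.inl (hnz a h)
    obtain ⟨hsum, hmom, hdiff⟩ := hdef habs hsn
    exact ⟨hsum, hmom, hdiff, expansion_of_isActive hindep hlaw hc hlam hi habs (hall hsn) hdich
      (hnz _ hne) hmax⟩
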